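/- Let $f>0$ and let $\mathcal P$ be the parabola $y^2=-4fx$, with vertex $(0,0)$, focus $F=(-f,0)$ and directrix $x=f$. For $r>0$ let $\mathcal Q$ be the family of all quadrilaterals $P_1P_2P_3P_4$ with four distinct vertices on $\mathcal P$ whose four sides (segments) are tangent to the circle of radius $r$ centred at $F$. Then $\mathcal Q$ is non-empty if and only if $r/f=2\sqrt{\sqrt5-2}$; suppose from now on that this is so. For each quadrilateral in $\mathcal Q$ let $P_1'P_2'P_3'P_4'$ be its polar quadrilateral, bounded by the tangents to $\mathcal P$ at the $P_i$ ($P_i'$ is the intersection of the tangents at $P_i$ and $P_{i+1}$, indices modulo $4$), and let $$C_1'=\frac{\sum_{i=1}^4 |P_i'P_{i+1}'|\,\tfrac12(P_i'+P_{i+1}')}{\sum_{i=1}^4 |P_i'P_{i+1}'|}$$ be its perimeter centroid. Over $\mathcal Q$, the locus of $C_1'$ (the set of all points $C_1'$) is equal to one connected component of the real algebraic curve given by the following polynomial equation, of degree exactly ten: $$\begin{aligned} &-(1457008\sqrt5+3257968)fx^{7}y^{2}+(122156\sqrt5+273148)f^{2}x^{4}y^{4}+(465164\sqrt5+1040132)f^{2}x^{6}y^{2}\\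 &-(96506\sqrt5+215698)f^{6}x^{2}y^{2}-(119256\sqrt5+266664)f^{3}x^{3}y^{4}+(505052\sqrt5+1129268)f^{5}x^{3}y^{2}\\ &+(8564\sqrt5+19204)f^{7}xy^{2}-(881712\sqrt5+1971568)x^{10}+(43955\sqrt5+98289)f^{4}x^{2}y^{4}\\ &+(24568\sqrt5+54936)fx^{5}y^{4}-(7250\sqrt5+16210)f^{5}xy^{4}-(1274930\sqrt5+2850838)f^{4}x^{4}y^{2}\\ &+(1235568\sqrt5+2762832)f^{3}x^{5}y^{2}+(4457696\sqrt5+9967712)fx^{9}-(7787152\sqrt5+17412608)f^{2}x^{8}\\ &+(5470456\sqrt5+12232344)f^{3}x^{7}-(755997\sqrt5+1690535)f^{4}x^{6}-(812098\sqrt5+1815898)f^{5}x^{5}\\ &+(330322\sqrt5+738968)f^{6}x^{4}+(448\sqrt5+1002)f^{6}y^{4}-(228\sqrt5+672)f^{8}y^{2}\\ &-(7300\sqrt5+16956)f^{7}x^{3}+(2750\sqrt5+7150)f^{9}x-(16145\sqrt5+36103)f^{8}x^{2}\\ &-(84196\sqrt5+188268)x^{6}y^{4}+(544928\sqrt5+1218496)x^{8}y^{2}-726f^{10}=0.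 \end{aligned}$$ Furthermore, the locus of $C_1'$ lies between the two lines, parallel to the directrix, $$x=\frac{(5+\sqrt2-\sqrt5\sqrt2-\sqrt5)f}{2}\quad\text{and}\quad x=\frac{(\sqrt5\sqrt2-\sqrt5-2\sqrt2+3)f}{2},$$ whose distance $d$ is approximately $f/25$: $|d-f/25|<f/1000$. -/

import Mathlib

open EuclideanGeometry

noncomputable section

namespace PolarQuad

/-- The Euclidean plane; coordinate `0` is the abscissa and coordinate `1` the ordinate. -/
abbrev Plane : Type := EuclideanSpace ℝ (Fin 2)

/-- The parabola `y² = -4 f x`, of focal distance `f`, with vertex at the origin, focus `(-f, 0)`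
and directrix `x = f`. -/
def parabola (f : ℝ) : Set Plane := {p | p 1 ^ 2 = -4 * f * p 0}

def focus (f : ℝ) : Plane := !₂[-f, 0]

/-- The tangent line to the parabola `y² = -4 f x` at its point `p`. -/
def tangentLine (f : ℝ) (p : Plane) : Set Plane := {q | p 1 * q 1 = -2 * f * (q 0 + p 0)}

/-- The circle of radius `r` centred at the focus. -/
def focalCircle (f r : ℝ) : Sphere Plane := ⟨focus f, r⟩

/-- The side from `a` to `b` (a segment) is tangent to the circle `s`. -/
def SideTangent (s : Sphere Plane) (a b : Plane) : Prop :=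
  ∃ t ∈ segment ℝ a b, s.IsTangentAt t (line[ℝ, a, b])

/-- The family of quadrilaterals (with four distinct vertices, in cyclic order) inscribed in the
parabola and circumscribing the focus-centred circle of radius `r`. -/
def ponceletFamily (f r : ℝ) : Set (Fin 4 → Plane) :=
  {P | Function.Injective P ∧ (∀ i, P i ∈ parabola f) ∧
    ∀ i, SideTangent (focalCircle f r) (P i) (P (i + 1))}

/-- `P'` is the polar quadrilateral of `P`: it is bounded by the tangents to the parabola at the
vertices of `P`, its vertex `P' i` being where the tangents at `P i` and `P (i + 1)` meet. -/
def IsPolar (f : ℝ) (P P' : Fin 4 → Plane) : Prop :=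
  ∀ i, P' i ∈ tangentLine f (P i) ∩ tangentLine f (P (i + 1))

/-- The perimeter centroid of a quadrilateral: the mean of the midpoints of its sides, weighted by
the lengths of the sides. -/
def perimeterCentroid (V : Fin 4 → Plane) : Plane :=
  (∑ i, dist (V i) (V (i + 1)))⁻¹ • ∑ i, dist (V i) (V (i + 1)) • midpoint ℝ (V i) (V (i + 1))

/-- The locus of the perimeter centroid of the polar quadrilateral over the family. -/
def polarPerimeterLocus (f r : ℝ) : Set Plane :=
  {c | ∃ P ∈ ponceletFamily f r, ∃ P', IsPolar f P P' ∧ c = perimeterCentroid P'}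

open MvPolynomial in
/-- The defining polynomial of the curve; `X 0` is `x` and `X 1` is `y`. -/
def curvePoly (f : ℝ) : MvPolynomial (Fin 2) ℝ :=
    -C ((1457008 * √5 + 3257968) * f) * X 0 ^ 7 * X 1 ^ 2
    + C ((122156 * √5 + 273148) * f ^ 2) * X 0 ^ 4 * X 1 ^ 4
    + C ((465164 * √5 + 1040132) * f ^ 2) * X 0 ^ 6 * X 1 ^ 2
    - C ((96506 * √5 + 215698) * f ^ 6) * X 0 ^ 2 * X 1 ^ 2
    - C ((119256 * √5 + 266664) * f ^ 3) * X 0 ^ 3 * X 1 ^ 4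
    + C ((505052 * √5 + 1129268) * f ^ 5) * X 0 ^ 3 * X 1 ^ 2
    + C ((8564 * √5 + 19204) * f ^ 7) * X 0 * X 1 ^ 2
    - C (881712 * √5 + 1971568) * X 0 ^ 10
    + C ((43955 * √5 + 98289) * f ^ 4) * X 0 ^ 2 * X 1 ^ 4
    + C ((24568 * √5 + 54936) * f) * X 0 ^ 5 * X 1 ^ 4
    - C ((7250 * √5 + 16210) * f ^ 5) * X 0 * X 1 ^ 4
    - C ((1274930 * √5 + 2850838) * f ^ 4) * X 0 ^ 4 * X 1 ^ 2
    + C ((1235568 * √5 + 2762832) * f ^ 3) * X 0 ^ 5 * X 1 ^ 2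
    + C ((4457696 * √5 + 9967712) * f) * X 0 ^ 9
    - C ((7787152 * √5 + 17412608) * f ^ 2) * X 0 ^ 8
    + C ((5470456 * √5 + 12232344) * f ^ 3) * X 0 ^ 7
    - C ((755997 * √5 + 1690535) * f ^ 4) * X 0 ^ 6
    - C ((812098 * √5 + 1815898) * f ^ 5) * X 0 ^ 5
    + C ((330322 * √5 + 738968) * f ^ 6) * X 0 ^ 4
    + C ((448 * √5 + 1002) * f ^ 6) * X 1 ^ 4
    - C ((228 * √5 + 672) * f ^ 8) * X 1 ^ 2
    - C ((7300 * √5 + 16956) * f ^ 7) * X 0 ^ 3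
    + C ((2750 * √5 + 7150) * f ^ 9) * X 0
    - C ((16145 * √5 + 36103) * f ^ 8) * X 0 ^ 2
    - C (84196 * √5 + 188268) * X 0 ^ 6 * X 1 ^ 4
    + C (544928 * √5 + 1218496) * X 0 ^ 8 * X 1 ^ 2
    - C (726 * f ^ 10)

/-- The real affine algebraic curve cut out by `curvePoly f`. -/
def curve (f : ℝ) : Set Plane := {p | MvPolynomial.eval (fun i => p i) (curvePoly f) = 0}

/-- Abscissae of the two bounding lines, which are parallel to the directrix `x = f`. -/
def lowerLine (f : ℝ) : ℝ := (5 + √2 - √5 * √2 - √5) * f / 2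

def upperLine (f : ℝ) : ℝ := (√5 * √2 - √5 - 2 * √2 + 3) * f / 2

end PolarQuad

end

/-! ### The curve polynomial as a quadratic in `y ^ 2` -/

noncomputable section

namespace PolarQuad

/-! Write the vertices as `(-f t², 2 f t)` and put `ρ = r² / (4 f²)`. The chord through parameters
`s`, `t` touches the circle iff `(1 + s t)² = ρ (4 + (s + t)²)`. The two neighbours of a vertex are
thus roots of one quadratic, and comparing Vieta's formulas at opposite vertices (`closed_chain`)
forces `ρ² + 4 ρ = 1`, or `ρ = 1`. The latter is impossible because the sides are segments. So `ρ =
2 h - 1` with `h = (√5 - 1) / 2`, opposite parameters have product `-ρ`, and the two opposite sums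
have product `-4 h²`. Conversely these relations give a quadrilateral of the family
(`chord_of_products`).

Setting the opposite sums to `2 h tan α` and `-2 h cot α`, with `s = sin α` and `c = cos α`, makes
`√((1 + t₀²)(1 + t₂²))` rational in `s`, `c`. One radical `R`, the ratio of the weights of the two
pairs of opposite sides, remains, and the centroid becomes `(locusX, locusY)` (`centroid_eq_locus`).
Squaring `R` away puts the abscissa and `n = 1 / (1 + s + c)` on a conic. The square of the ordinate
is rational on that conic, and taking norms in the quadratic extension generated by `n` eliminates
`n` and leaves the curve (`coeff_eq_zero_of_conic`, `locus_on_curve`).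

For the component, divide by `f` and regard the equation as `A z² + B z + C = 0` in `z = y²`.
Between `x = 1/2` and the upper line the signs of `A`, `B`, `C` exclude points left of the lower
line or on the upper line, and leave at most one `z ≥ 0` elsewhere (`strip_bounds`, `strip_unique`).
The locus attains every abscissa in this range and is symmetric in the axis, so it is exactly the
part of the curve in the strip. It is connected, and the curve misses the edges of the strip, so it
is a full component (`paramLocus_eq_component`). -/

/-- The coefficient of `y ^ 4` in the curve for `f = 1`; `h` stands for `(√5 - 1) / 2`. -/
def coeffA (h x : ℝ) : ℝ :=
  -(272464 + 168392 * h) * ((x - h ^ 2) ^ 2 - h ^ 6 / 2) ^ 2 * ((x + h) ^ 2 - 2 * h ^ 2)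

/-- The coefficient of `y ^ 2` in the curve for `f = 1`. -/
def coeffB (h x : ℝ) : ℝ :=
  (-900 - 456 * h) + (27768 + 17128 * h) * x - (312204 + 193012 * h) * x ^ 2
    + (1634320 + 1010104 * h) * x ^ 3 - (4125768 + 2549860 * h) * x ^ 4
    + (3998400 + 2471136 * h) * x ^ 5 + (1505296 + 930328 * h) * x ^ 6
    - (4714976 + 2914016 * h) * x ^ 7 + (1763424 + 1089856 * h) * x ^ 8

/-- The square root of the coefficient of `y ^ 0`, up to an elementary factor. -/
def quarticC (h x : ℝ) : ℝ :=
  (97 / 4 * h - 15) + (7 / 2 - 11 / 2 * h) * x + (9 / 2 - 29 / 4 * h) * x ^ 2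
    + (3 * h - 3) * x ^ 3 + x ^ 4

/-- The coefficient of `y ^ 0` in the curve for `f = 1`. -/
def coeffC (h x : ℝ) : ℝ :=
  -(2853280 + 1763424 * h) * ((x - 2 + h) ^ 2 - 2 * h ^ 2) * quarticC h x ^ 2

theorem coeffA_expand {h : ℝ} (hh : h ^ 2 = 1 - h) (x : ℝ) :
    coeffA h x = (448 * (2 * h + 1) + 1002) - (7250 * (2 * h + 1) + 16210) * x
      + (43955 * (2 * h + 1) + 98289) * x ^ 2 - (119256 * (2 * h + 1) + 266664) * x ^ 3
      + (122156 * (2 * h + 1) + 273148) * x ^ 4 + (24568 * (2 * h + 1) + 54936) * x ^ 5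
      - (84196 * (2 * h + 1) + 188268) * x ^ 6 := by
  unfold coeffA
  grind

theorem coeffC_expand {h : ℝ} (hh : h ^ 2 = 1 - h) (x : ℝ) :
    coeffC h x = -726 + (2750 * (2 * h + 1) + 7150) * x - (16145 * (2 * h + 1) + 36103) * x ^ 2
      - (7300 * (2 * h + 1) + 16956) * x ^ 3 + (330322 * (2 * h + 1) + 738968) * x ^ 4
      - (812098 * (2 * h + 1) + 1815898) * x ^ 5 - (755997 * (2 * h + 1) + 1690535) * x ^ 6
      + (5470456 * (2 * h + 1) + 12232344) * x ^ 7 - (7787152 * (2 * h + 1) + 17412608) * x ^ 8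
      + (4457696 * (2 * h + 1) + 9967712) * x ^ 9
      - (881712 * (2 * h + 1) + 1971568) * x ^ 10 := by
  unfold coeffC quarticC
  grind

/-- The polynomial is homogeneous of degree ten in `f`, `x`, `y` together, which reduces everything
to `f = 1`. -/
theorem eval_curvePoly {f h : ℝ} (hh : h ^ 2 = 1 - h) (h5 : √5 = 2 * h + 1) (v : Fin 2 → ℝ)
    (x y : ℝ) (hx : v 0 = f * x) (hy : v 1 = f * y) :
    MvPolynomial.eval v (curvePoly f)
      = f ^ 10 * (coeffA h x * (y ^ 2) ^ 2 + coeffB h x * y ^ 2 + coeffC h x) := by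
  rw [coeffA_expand hh, coeffC_expand hh]
  simp only [curvePoly, coeffB, map_add, map_sub, map_neg, map_mul, map_pow, MvPolynomial.eval_C,
    MvPolynomial.eval_X, hx, hy, h5]
  ring

open MvPolynomial in
theorem totalDegree_monomial_le (a : ℝ) (i j : ℕ) (hij : i + j ≤ 10) :
    (C a * X 0 ^ i * X 1 ^ j : MvPolynomial (Fin 2) ℝ).totalDegree ≤ 10 := by
  refine (totalDegree_mul _ _).trans ?_
  have h1 := totalDegree_mul (C a) (X 0 ^ i : MvPolynomial (Fin 2) ℝ)
  simp only [totalDegree_C, totalDegree_X_pow] at *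
  omega

open MvPolynomial in
theorem totalDegree_curvePoly (f : ℝ) : (curvePoly f).totalDegree = 10 := by
  apply le_antisymm
  · have m := totalDegree_monomial_le
    have m0 : ∀ (a : ℝ) (i : ℕ), i ≤ 10 →
        (C a * X 0 ^ i : MvPolynomial (Fin 2) ℝ).totalDegree ≤ 10 := fun a i hi => by
      simpa using m a i 0 (by omega)
    have m1 : ∀ (a : ℝ) (j : ℕ), j ≤ 10 →
        (C a * X 1 ^ j : MvPolynomial (Fin 2) ℝ).totalDegree ≤ 10 := fun a j hj => by
      simpa using m a 0 j (by omega)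
    have m2 : ∀ (a : ℝ) (j : ℕ), j ≤ 9 →
        (C a * X 0 * X 1 ^ j : MvPolynomial (Fin 2) ℝ).totalDegree ≤ 10 := fun a j hj => by
      simpa using m a 1 j (by omega)
    have m3 : ∀ (a : ℝ), (C a * X 0 : MvPolynomial (Fin 2) ℝ).totalDegree ≤ 10 := fun a => by
      simpa using m a 1 0 (by omega)
    have ma : ∀ p q : MvPolynomial (Fin 2) ℝ, p.totalDegree ≤ 10 → q.totalDegree ≤ 10 →
        (p + q).totalDegree ≤ 10 := fun p q hp hq => (totalDegree_add p q).trans (max_le hp hq)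
    have ms : ∀ p q : MvPolynomial (Fin 2) ℝ, p.totalDegree ≤ 10 → q.totalDegree ≤ 10 →
        (p - q).totalDegree ≤ 10 := fun p q hp hq => (totalDegree_sub p q).trans (max_le hp hq)
    unfold curvePoly
    repeat' first
      | with_reducible refine ma _ _ ?_ ?_
      | with_reducible refine ms _ _ ?_ ?_
    all_goals first
      | (with_reducible refine m _ _ _ ?_; norm_num)
      | (with_reducible refine m0 _ _ ?_; norm_num)
      | (with_reducible refine m1 _ _ ?_; norm_num)
      | (with_reducible refine m2 _ _ ?_; norm_num)
      | with_reducible exact m3 _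
      | (rw [totalDegree_C]; norm_num)
      | (rw [neg_mul, neg_mul, totalDegree_neg]
         with_reducible refine m _ _ _ ?_
         norm_num)
  -- Restricting to `y = 0` cannot raise the degree, and the term in `x ^ 10` survives there.
  · have key := aeval_natDegree_le (curvePoly f) le_rfl
      (![Polynomial.X, 0] : Fin 2 → Polynomial ℝ) (n := 1) (by
        intro i; fin_cases i <;> simp)
    have : (aeval (![Polynomial.X, 0] : Fin 2 → Polynomial ℝ) (curvePoly f)).natDegree = 10 := by
      simp only [curvePoly, map_add, map_sub, map_neg, map_mul, map_pow, aeval_C, aeval_X,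
        Matrix.cons_val_zero, Matrix.cons_val_one, Polynomial.algebraMap_eq]
      simp only [ne_eq, OfNat.ofNat_ne_zero, not_false_eq_true, zero_pow, mul_zero,
        add_zero, sub_zero, zero_sub]
      compute_degree!
      simp only [← Polynomial.C_mul, ← Polynomial.C_add, Polynomial.coeff_C_mul,
        Polynomial.coeff_X_pow_self]
      positivity
    omega

/-! ### Eliminating the radical and the parameter -/

/-- The abscissa and the number `n = 1 / (1 + sin α + cos α)` lie on a conic. -/
theorem conic_of_ratio {h s c R ξ : ℝ} (hh : h ^ 2 = 1 - h) (hc : 0 < c)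
    (hsc : s ^ 2 + c ^ 2 = 1) (hne : s ≠ c)
    (hR : R ^ 2 * ((1 - h * c) * (1 + s)) = (1 - h * s) * (1 + c))
    (hξ : R * ((1 + s) * (1 - ξ * (1 + c))) = (1 + c) * (ξ * (1 + s) - 1)) :
    (ξ ^ 2 - 2 * h ^ 2 * ξ) * (1 + s + c) ^ 2 = 2 * h - 2 * h ^ 2 * (1 + s + c) := by
  have e1 : (1 - h * s) * (1 + s) * (1 - ξ * (1 + c)) ^ 2
      = (1 - h * c) * (1 + c) * (ξ * (1 + s) - 1) ^ 2 := by
    have hq : (1 + c) ≠ 0 := by positivity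
    apply mul_left_cancel₀ hq
    have := congrArg (fun t => t ^ 2 * (1 - h * c)) hξ
    simp only [mul_pow] at this
    linear_combination this - (1 + s) * (1 - ξ * (1 + c)) ^ 2 * hR
  -- Exchanging `s` and `c` swaps the two sides of `e1`, so their difference is divisible by `s -
  -- c`; the cofactor is symmetric.
  have e2 : (s - c) * ((1 + h) * ((1 + s) * (1 + c)) * ξ ^ 2 - 2 * h * ((1 + s) * (1 + c)) * ξ
      - (1 - h) + h * (s + c)) = 0 := by
    linear_combination -e1
  have e3 := (mul_eq_zero.mp e2).resolve_left (sub_ne_zero.mpr hne)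
  have e4 : (1 + s) * (1 + c) = (1 + s + c) ^ 2 / 2 := by linear_combination (-1 / 2) * hsc
  rw [e4] at e3
  linear_combination 2 * h * e3 - (1 + s + c) ^ 2 * ξ ^ 2 * hh

/-- Both relations are affine in `R`, so `R` is eliminated by cross-multiplication, without
squaring. -/
theorem ordinate_eq {s c R ξ y k l : ℝ}
    (hξ : R * ((1 + s) * (1 - ξ * (1 + c))) = (1 + c) * (ξ * (1 + s) - 1))
    (hy : y * (s * c) * (1 + R) = k - R * l) :
    y * (s * c) * (s - c) = k * (1 + s) + l * (1 + c) - ξ * ((1 + s) * (1 + c)) * (k + l) := by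
  linear_combination (1 + s) * (1 - ξ * (1 + c)) * hy - (y * (s * c) + l) * hξ

section Elimination

variable (h x : ℝ)

/-- The constant term of the conic `n ^ 2 = h * n + conicK h x`. -/
def conicK : ℝ := (1 - h) / 2 - (1 + h) * x + (3 / 2 + h) * x ^ 2

/-- Constant part of the denominator of `y ^ 2`, reduced modulo the conic. -/
def denom₀ : ℝ := (-5 / 2 + 1 / 2 * h) + (7 + 3 * h) * x - (1 / 2 + h) * x ^ 2
  - (20 + 12 * h) * x ^ 3 + (13 + 8 * h) * x ^ 4

/-- Linear part of the denominator of `y ^ 2`, reduced modulo the conic. -/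
def denom₁ : ℝ := (4 - h) - (12 + 4 * h) * x + (14 + 8 * h) * x ^ 2

/-- Constant part of the numerator of `y`, reduced modulo the conic. -/
def numer₀ : ℝ := -1 + (1 + h) * x - (3 + 2 * h) * x ^ 2

/-- Linear part of the numerator of `y`, reduced modulo the conic. -/
def numer₁ : ℝ := (2 * h - 1) + (7 + 2 * h) * x - (4 + 2 * h) * x ^ 2

variable {h x}

/-- For `n = 1 / (1 + s + c)` on the unit circle the left side is the square of `2 n³ s c (s - c)`,
the factor by which the ordinate gets multiplied. -/
theorem denom_reduce {n : ℝ} (hh : h ^ 2 = 1 - h) (hn : n ^ 2 = h * n + conicK h x) :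
    (n ^ 2 + 2 * n - 1) * (1 - 2 * n) ^ 2 = denom₀ h x + denom₁ h x * n := by
  unfold denom₀ denom₁
  unfold conicK at hn
  grind

theorem numer_reduce {n : ℝ} (hh : h ^ 2 = 1 - h) (hn : n ^ 2 = h * n + conicK h x) :
    -4 * h * n ^ 3 + 2 * (1 - 2 * h) * n ^ 2 + (3 * h - 1) * (3 * n - 1)
        - ((1 + h) * x - (2 * h - 1)) * (1 - (2 + h) * n) = numer₀ h x + numer₁ h x * n := by
  unfold numer₀ numer₁
  unfold conicK at hn
  grind

/-- The left side is the norm of `denom₀ + denom₁ * n`, the conjugate of `n` being `h - n`. The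
factor in front of `coeffA` recurs in the next two identities and will cancel. -/
theorem norm_denom (hh : h ^ 2 = 1 - h) :
    denom₀ h x ^ 2 + h * denom₀ h x * denom₁ h x - conicK h x * denom₁ h x ^ 2
      = (65 * h - 41) / 968 * ((x - 2 + h) ^ 2 - 2 * h ^ 2) * coeffA h x := by
  unfold denom₀ denom₁ conicK coeffA
  grind

theorem norm_numer (hh : h ^ 2 = 1 - h) :
    (numer₀ h x ^ 2 + h * numer₀ h x * numer₁ h x - conicK h x * numer₁ h x ^ 2) ^ 2
      = (65 * h - 41) / 968 * ((x - 2 + h) ^ 2 - 2 * h ^ 2) * coeffC h x := by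
  have e : numer₀ h x ^ 2 + h * numer₀ h x * numer₁ h x - conicK h x * numer₁ h x ^ 2
      = -(42 + 26 * h) * (((x - 2 + h) ^ 2 - 2 * h ^ 2) * quarticC h x) := by
    unfold numer₀ numer₁ conicK quarticC
    grind
  rw [e, coeffC]
  generalize ((x - 2 + h) ^ 2 - 2 * h ^ 2) = a
  generalize quarticC h x = b
  grind

/-- With `d` the reduced denominator and `m` the reduced numerator, this is the trace of the
conjugate of `d` times `m²`, the cross term in the norm of `z d - m²`. -/
theorem trace_numer_denom (hh : h ^ 2 = 1 - h) :
    2 * denom₀ h x * (numer₀ h x ^ 2 + numer₁ h x ^ 2 * conicK h x)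
      + h * (denom₀ h x * (2 * numer₀ h x * numer₁ h x + h * numer₁ h x ^ 2)
        + denom₁ h x * (numer₀ h x ^ 2 + numer₁ h x ^ 2 * conicK h x))
      - 2 * conicK h x * denom₁ h x * (2 * numer₀ h x * numer₁ h x + h * numer₁ h x ^ 2)
      = -((65 * h - 41) / 968 * ((x - 2 + h) ^ 2 - 2 * h ^ 2) * coeffB h x) := by
  unfold numer₀ numer₁ denom₀ denom₁ conicK coeffB
  grind

/-- Elimination of `n` between the conic and the equation for `y ^ 2`. -/
theorem coeff_eq_zero_of_conic {n z : ℝ} (hh : h ^ 2 = 1 - h) (h41 : 65 * h - 41 ≠ 0)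
    (hx : (x - 2 + h) ^ 2 - 2 * h ^ 2 ≠ 0) (hn : n ^ 2 = h * n + conicK h x)
    (hz : z * ((n ^ 2 + 2 * n - 1) * (1 - 2 * n) ^ 2)
      = (-4 * h * n ^ 3 + 2 * (1 - 2 * h) * n ^ 2 + (3 * h - 1) * (3 * n - 1)
        - ((1 + h) * x - (2 * h - 1)) * (1 - (2 + h) * n)) ^ 2) :
    coeffA h x * z ^ 2 + coeffB h x * z + coeffC h x = 0 := by
  rw [denom_reduce hh hn, numer_reduce hh hn] at hz
  have hA := norm_denom (x := x) hh
  have hC := norm_numer (x := x) hh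
  have hB := trace_numer_denom (x := x) hh
  generalize denom₀ h x = d₀ at *
  generalize denom₁ h x = d₁ at *
  generalize numer₀ h x = m₀ at *
  generalize numer₁ h x = m₁ at *
  generalize conicK h x = K at *
  have hk : (65 * h - 41) / 968 * ((x - 2 + h) ^ 2 - 2 * h ^ 2) ≠ 0 :=
    mul_ne_zero (div_ne_zero h41 (by norm_num)) hx
  apply mul_left_cancel₀ hk
  generalize (65 * h - 41) / 968 * ((x - 2 + h) ^ 2 - 2 * h ^ 2) = κ at *
  have he : (z * d₀ - (m₀ ^ 2 + m₁ ^ 2 * K)) + (z * d₁ - (2 * m₀ * m₁ + h * m₁ ^ 2)) * n = 0 := by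
    linear_combination hz + m₁ ^ 2 * hn
  generalize he₀ : z * d₀ - (m₀ ^ 2 + m₁ ^ 2 * K) = e₀ at he
  generalize he₁ : z * d₁ - (2 * m₀ * m₁ + h * m₁ ^ 2) = e₁ at he
  -- Multiplying `e₀ + e₁ n = 0` by its conjugate `e₀ + e₁ (h - n)` removes `n`.
  have hN : e₀ ^ 2 + h * e₀ * e₁ - K * e₁ ^ 2 = 0 := by
    linear_combination (e₀ + e₁ * (h - n)) * he + e₁ ^ 2 * hn
  rw [← he₀, ← he₁] at hN
  linear_combination hN - z ^ 2 * hA - hC + z * hB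

end Elimination

/-! ### Signs of the coefficients near the locus -/

section Strip

variable {h w x z : ℝ}

theorem golden_bounds (hh : h ^ 2 = 1 - h) (h0 : 0 < h) :
    618033 / 1000000 < h ∧ h < 618034 / 1000000 := by
  constructor <;> nlinarith

theorem sqrt_two_bounds (hw : w ^ 2 = 2) (w0 : 0 < w) :
    141421 / 100000 < w ∧ w < 141422 / 100000 := by
  constructor <;> nlinarith

theorem factor_lower (hh : h ^ 2 = 1 - h) (hw : w ^ 2 = 2) :
    (x - 2 + h) ^ 2 - 2 * h ^ 2
      = (x - h * (2 * h + 1 - w)) * (x - (2 - h + h * w)) := by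
  grind

theorem factor_upper (hw : w ^ 2 = 2) :
    (x - h ^ 2) ^ 2 - h ^ 6 / 2
      = (x - (h ^ 2 + h ^ 3 * w / 2)) * (x - h ^ 2 + h ^ 3 * w / 2) := by
  linear_combination (h ^ 6 / 4) * hw

theorem line_bounds (hh : h ^ 2 = 1 - h) (h0 : 0 < h) (hw : w ^ 2 = 2) (w0 : 0 < w) :
    5079 / 10000 < h * (2 * h + 1 - w) ∧ h * (2 * h + 1 - w) < 508 / 1000 ∧
    5488 / 10000 < h ^ 2 + h ^ 3 * w / 2 ∧ h ^ 2 + h ^ 3 * w / 2 < 549 / 1000 := by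
  obtain ⟨a, b⟩ := golden_bounds hh h0
  obtain ⟨c, d⟩ := sqrt_two_bounds hw w0
  have h3 : h ^ 3 = 2 * h - 1 := by linear_combination (h - 1) * hh
  rw [h3, hh]
  have e : h * (2 * h + 1 - w) = 2 - h - h * w := by linear_combination 2 * hh
  rw [e]
  refine ⟨?_, ?_, ?_, ?_⟩ <;> nlinarith

theorem coeffA_neg (hh : h ^ 2 = 1 - h) (h0 : 0 < h) (hw : w ^ 2 = 2) (w0 : 0 < w)
    (hx : 1 / 2 ≤ x) (hx' : x < h ^ 2 + h ^ 3 * w / 2) : coeffA h x < 0 := by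
  obtain ⟨a, b⟩ := golden_bounds hh h0
  have hp : (x - h ^ 2) ^ 2 - h ^ 6 / 2 ≠ 0 := by
    rw [factor_upper hw]
    refine mul_ne_zero (by linarith) ?_
    have : 0 < h ^ 3 * w := by positivity
    have : 0 < x - h ^ 2 + h ^ 3 * w / 2 := by linarith
    exact this.ne'
  have hq : 0 < (x + h) ^ 2 - 2 * h ^ 2 := by nlinarith
  have : 0 < (272464 + 168392 * h) * ((x - h ^ 2) ^ 2 - h ^ 6 / 2) ^ 2
      * ((x + h) ^ 2 - 2 * h ^ 2) := by positivity
  unfold coeffA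
  linarith

/-- Only non-vanishing matters, since the quartic enters `coeffC` squared. The estimate uses the
Taylor expansion at `1 / 2`. -/
theorem quarticC_neg (hh : h ^ 2 = 1 - h) (h0 : 0 < h) (hx : 1 / 2 ≤ x) (hx' : x ≤ 55 / 100) :
    quarticC h x < 0 := by
  obtain ⟨a, b⟩ := golden_bounds hh h0
  obtain ⟨t, rfl⟩ : ∃ t, x = 1 / 2 + t := ⟨x - 1 / 2, by ring⟩
  have t0 : 0 ≤ t := by linarith
  have t1 : t ≤ 1 / 20 := by linarith
  have e : quarticC h (1 / 2 + t) = (321 / 16 * h - 199 / 16) + (25 / 4 - 21 / 2 * h) * t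
      + (3 / 2 - 11 / 4 * h) * t ^ 2 + (3 * h - 1) * t ^ 3 + t ^ 4 := by
    unfold quarticC; ring
  rw [e]
  have h3 : t ^ 3 ≤ 1 / 20 * t ^ 2 := by nlinarith [sq_nonneg t]
  have h4 : t ^ 4 ≤ 1 / 400 * t ^ 2 := by nlinarith [sq_nonneg t, mul_nonneg t0 (sq_nonneg t)]
  have g1 : (25 / 4 - 21 / 2 * h) * t ≤ 0 := mul_nonpos_of_nonpos_of_nonneg (by linarith) t0
  have g2 : (3 / 2 - 11 / 4 * h) * t ^ 2 ≤ -(19 / 100) * t ^ 2 := by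
    apply mul_le_mul_of_nonneg_right _ (sq_nonneg t); linarith
  have g3 : (3 * h - 1) * t ^ 3 ≤ 9 / 10 * t ^ 3 := by
    apply mul_le_mul_of_nonneg_right _ (by positivity); linarith
  nlinarith [sq_nonneg t]

/-- In the Taylor expansion at `1 / 2` the constant term is about `-113`, while the positive terms
add up to less than `56` on this short interval. -/
theorem coeffB_neg (hh : h ^ 2 = 1 - h) (h0 : 0 < h) (hx : 1 / 2 ≤ x) (hx' : x ≤ 508 / 1000) :
    coeffB h x < 0 := by
  obtain ⟨a, b⟩ := golden_bounds hh h0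
  obtain ⟨t, rfl⟩ : ∃ t, x = 1 / 2 + t := ⟨x - 1 / 2, by ring⟩
  have t0 : 0 ≤ t := by linarith
  have t1 : t ≤ 8 / 1000 := by linarith
  have e : coeffB h (1 / 2 + t) = (21 / 8 * h - 917 / 8) + (9353 / 2 + 2826 * h) * t
      + (37134 + 45891 / 2 * h) * t ^ 2 - (85994 + 53118 * h) * t ^ 3
      - (1397948 + 863990 * h) * t ^ 4 - (3895368 + 2407472 * h) * t ^ 5
      - (2653152 + 1639736 * h) * t ^ 6 + (2338720 + 1445408 * h) * t ^ 7
      + (1763424 + 1089856 * h) * t ^ 8 := by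
    unfold coeffB; ring
  rw [e]
  have p3 : 0 ≤ (85994 + 53118 * h) * t ^ 3 := by positivity
  have p4 : 0 ≤ (1397948 + 863990 * h) * t ^ 4 := by positivity
  have p5 : 0 ≤ (3895368 + 2407472 * h) * t ^ 5 := by positivity
  have g1 : (9353 / 2 + 2826 * h) * t ≤ 6500 * (8 / 1000) := by gcongr; linarith
  have g2 : (37134 + 45891 / 2 * h) * t ^ 2 ≤ 52000 * (8 / 1000) ^ 2 := by gcongr; linarith
  have g7 : (2338720 + 1445408 * h) * t ^ 7 ≤ 4000000 * (8 / 1000) ^ 7 := by gcongr; linarith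
  have g8 : (1763424 + 1089856 * h) * t ^ 8 ≤ 4000000 * (8 / 1000) ^ 8 := by gcongr; linarith
  have p6 : 0 ≤ (2653152 + 1639736 * h) * t ^ 6 := by positivity
  norm_num at g2 g7 g8
  linarith

theorem coeffB_pos (hh : h ^ 2 = 1 - h) (h0 : 0 < h) (hx : 548 / 1000 ≤ x) (hx' : x ≤ 55 / 100) :
    0 < coeffB h x := by
  obtain ⟨a, b⟩ := golden_bounds hh h0
  obtain ⟨t, rfl⟩ : ∃ t, x = 1 / 2 + t := ⟨x - 1 / 2, by ring⟩
  have t0 : 48 / 1000 ≤ t := by linarith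
  have t1 : t ≤ 5 / 100 := by linarith
  have e : coeffB h (1 / 2 + t) = (21 / 8 * h - 917 / 8) + (9353 / 2 + 2826 * h) * t
      + (37134 + 45891 / 2 * h) * t ^ 2 - (85994 + 53118 * h) * t ^ 3
      - (1397948 + 863990 * h) * t ^ 4 - (3895368 + 2407472 * h) * t ^ 5
      - (2653152 + 1639736 * h) * t ^ 6 + (2338720 + 1445408 * h) * t ^ 7
      + (1763424 + 1089856 * h) * t ^ 8 := by
    unfold coeffB; ring
  rw [e]
  have g1 : 6400 * (48 / 1000) ≤ (9353 / 2 + 2826 * h) * t := by gcongr; linarith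
  have g2 : 51000 * (48 / 1000) ^ 2 ≤ (37134 + 45891 / 2 * h) * t ^ 2 := by gcongr; linarith
  have p3 : (85994 + 53118 * h) * t ^ 3 ≤ 120000 * (5 / 100) ^ 3 := by gcongr; linarith
  have p4 : (1397948 + 863990 * h) * t ^ 4 ≤ 2000000 * (5 / 100) ^ 4 := by gcongr; linarith
  have p5 : (3895368 + 2407472 * h) * t ^ 5 ≤ 5500000 * (5 / 100) ^ 5 := by gcongr; linarith
  have p6 : (2653152 + 1639736 * h) * t ^ 6 ≤ 4000000 * (5 / 100) ^ 6 := by gcongr; linarith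
  have g7 : 0 ≤ (2338720 + 1445408 * h) * t ^ 7 := by positivity
  have g8 : 0 ≤ (1763424 + 1089856 * h) * t ^ 8 := by positivity
  norm_num at g1 g2 p3 p4 p5 p6
  linarith

/-- The constant coefficient has the sign of `x - h * (2 * h + 1 - w)` in the strip. -/
theorem coeffC_eq_mul (hh : h ^ 2 = 1 - h) (h0 : 0 < h) (hw : w ^ 2 = 2) (w0 : 0 < w)
    (hx : 1 / 2 ≤ x) (hx' : x ≤ 55 / 100) :
    ∃ k > 0, coeffC h x = k * (x - h * (2 * h + 1 - w)) := by
  have hq := quarticC_neg hh h0 hx hx'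
  obtain ⟨a, b⟩ := golden_bounds hh h0
  have hl : 0 < (2 - h + h * w) - x := by
    have : 0 < h * w := by positivity
    linarith
  refine ⟨(2853280 + 1763424 * h) * ((2 - h + h * w) - x) * quarticC h x ^ 2, ?_, ?_⟩
  · have : 0 < quarticC h x ^ 2 := by have := hq.ne; positivity
    positivity
  · rw [coeffC, factor_lower hh hw]
    ring

/-- In the strip between `x = 1 / 2` and the asymptote, the curve stays in the open region. -/
theorem strip_bounds (hh : h ^ 2 = 1 - h) (h0 : 0 < h) (hw : w ^ 2 = 2) (w0 : 0 < w)
    (hx : 1 / 2 ≤ x) (hx' : x ≤ h ^ 2 + h ^ 3 * w / 2) (hz : 0 ≤ z)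
    (hF : coeffA h x * z ^ 2 + coeffB h x * z + coeffC h x = 0) :
    h * (2 * h + 1 - w) ≤ x ∧ x < h ^ 2 + h ^ 3 * w / 2 := by
  obtain ⟨l1, l2, l3, l4⟩ := line_bounds hh h0 hw w0
  obtain ⟨k, hk, hC⟩ := coeffC_eq_mul hh h0 hw w0 hx (by linarith)
  constructor
  · by_contra! hlt
    have hA := coeffA_neg hh h0 hw w0 hx (by linarith)
    have hB := coeffB_neg hh h0 hx (by linarith)
    have : coeffC h x < 0 := by rw [hC]; exact mul_neg_of_pos_of_neg hk (by linarith)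
    have : coeffA h x * z ^ 2 ≤ 0 := mul_nonpos_of_nonpos_of_nonneg hA.le (sq_nonneg z)
    have : coeffB h x * z ≤ 0 := mul_nonpos_of_nonpos_of_nonneg hB.le hz
    linarith
  · refine lt_of_le_of_ne hx' fun heq => ?_
    have hA : coeffA h x = 0 := by
      rw [coeffA, factor_upper hw, heq]; ring
    have hB := coeffB_pos hh h0 (x := x) (by linarith) (by linarith)
    have : 0 < coeffC h x := by rw [hC]; exact mul_pos hk (by linarith)
    rw [hA] at hF
    nlinarith [mul_nonneg hB.le hz]

/-- By Vieta, two distinct roots have product `C / A`, which is negative inside the strip. On the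
lower line `C = 0`, and there the sum `-B / A` is negative. -/
theorem strip_unique {z' : ℝ} (hh : h ^ 2 = 1 - h) (h0 : 0 < h) (hw : w ^ 2 = 2) (w0 : 0 < w)
    (hx : h * (2 * h + 1 - w) ≤ x) (hx' : x < h ^ 2 + h ^ 3 * w / 2)
    (hz : 0 ≤ z) (hz' : 0 ≤ z')
    (hF : coeffA h x * z ^ 2 + coeffB h x * z + coeffC h x = 0)
    (hF' : coeffA h x * z' ^ 2 + coeffB h x * z' + coeffC h x = 0) : z = z' := by
  obtain ⟨l1, l2, l3, l4⟩ := line_bounds hh h0 hw w0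
  obtain ⟨k, hk, hC⟩ := coeffC_eq_mul hh h0 hw w0 (x := x) (by linarith) (by linarith)
  have hA := coeffA_neg hh h0 hw w0 (x := x) (by linarith) hx'
  by_contra hne
  have h1 : coeffA h x * (z + z') + coeffB h x = 0 := by
    apply mul_left_cancel₀ (sub_ne_zero.mpr hne)
    linear_combination hF - hF'
  have h2 : coeffC h x = coeffA h x * (z * z') := by linear_combination hF - z * h1
  rcases hx.eq_or_lt with heq | hlt
  · have hB := coeffB_neg hh h0 (x := x) (by linarith) (by linarith)
    nlinarith [mul_nonneg_of_nonpos_of_nonpos hA.le (by linarith : -(z + z') ≤ 0)]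
  · have : 0 < coeffC h x := by rw [hC]; exact mul_pos hk (by linarith)
    nlinarith [mul_nonneg hz hz']

end Strip

/-! ### The parametrised centroid lies on the curve -/

/-- The ratio of the weights of the two pairs of opposite sides. -/
def sideRatio (h s c : ℝ) : ℝ := √((1 - h * s) * (1 + c) / ((1 - h * c) * (1 + s)))

/-- The affinely normalised abscissa of the centroid. -/
def normAbscissa (h s c : ℝ) : ℝ :=
  (1 / (1 + s) + sideRatio h s c / (1 + c)) / (1 + sideRatio h s c)

/-- Abscissa of the centroid for `f = 1`, in terms of `s = sin α` and `c = cos α`. -/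
def locusX (h s c : ℝ) : ℝ := h * (2 * h - 1) + h * normAbscissa h s c

/-- Ordinate of the centroid for `f = 1`, in terms of `s = sin α` and `c = cos α`. -/
def locusY (h s c : ℝ) : ℝ :=
  ((h * s / c - c / s * ((2 * h - 1) + 1 / (1 + s)))
    + sideRatio h s c * (s / c * ((2 * h - 1) + 1 / (1 + c)) - h * c / s))
    / (1 + sideRatio h s c)

section Locus

variable {h w s c : ℝ}

theorem lt_one_of_sq_add_sq (hs : 0 < s) (hc : 0 < c) (hsc : s ^ 2 + c ^ 2 = 1) :
    s < 1 ∧ c < 1 := by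
  constructor <;> nlinarith

theorem one_sub_mul_pos (h0 : 0 < h) (h1 : h < 1) (hs1 : s < 1) :
    0 < 1 - h * s := by nlinarith

theorem sideRatio_pos (h0 : 0 < h) (h1 : h < 1) (hs : 0 < s) (hc : 0 < c)
    (hsc : s ^ 2 + c ^ 2 = 1) : 0 < sideRatio h s c := by
  obtain ⟨hs1, hc1⟩ := lt_one_of_sq_add_sq hs hc hsc
  have := one_sub_mul_pos h0 h1 hs1
  have := one_sub_mul_pos h0 h1 hc1
  exact Real.sqrt_pos.mpr (by positivity)

theorem sideRatio_sq (h0 : 0 < h) (h1 : h < 1) (hs : 0 < s) (hc : 0 < c)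
    (hsc : s ^ 2 + c ^ 2 = 1) :
    sideRatio h s c ^ 2 * ((1 - h * c) * (1 + s)) = (1 - h * s) * (1 + c) := by
  obtain ⟨hs1, hc1⟩ := lt_one_of_sq_add_sq hs hc hsc
  have := one_sub_mul_pos h0 h1 hs1
  have := one_sub_mul_pos h0 h1 hc1
  rw [sideRatio, Real.sq_sqrt (by positivity)]
  field_simp

theorem eq_sideRatio {R : ℝ} (h0 : 0 < h) (h1 : h < 1) (hs : 0 < s) (hc : 0 < c)
    (hsc : s ^ 2 + c ^ 2 = 1) (hR : 0 < R)
    (hR2 : R ^ 2 * ((1 - h * c) * (1 + s)) = (1 - h * s) * (1 + c)) :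
    R = sideRatio h s c := by
  obtain ⟨hs1, hc1⟩ := lt_one_of_sq_add_sq hs hc hsc
  have := one_sub_mul_pos h0 h1 hc1
  rw [sideRatio, eq_comm, Real.sqrt_eq_iff_mul_self_eq_of_pos hR, eq_div_iff (by positivity)]
  linear_combination hR2

/-- Exchanging `s` and `c` will act on the locus as reflection in the axis of the parabola. -/
theorem sideRatio_swap (h0 : 0 < h) (h1 : h < 1) (hs : 0 < s) (hc : 0 < c)
    (hsc : s ^ 2 + c ^ 2 = 1) : sideRatio h c s = (sideRatio h s c)⁻¹ := by
  have hp := sideRatio_pos h0 h1 hs hc hsc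
  have h2 := sideRatio_sq h0 h1 hs hc hsc
  refine (eq_sideRatio h0 h1 hc hs (by linarith) (inv_pos.mpr hp) ?_).symm
  rw [← h2]
  field_simp

theorem sideRatio_self (h1 : h < 1) (hs : 0 < s) (hs1 : s < 1) : sideRatio h s s = 1 := by
  have : 0 < 1 - h * s := by nlinarith
  rw [sideRatio, div_self (by positivity), Real.sqrt_one]

theorem locusX_swap (h0 : 0 < h) (h1 : h < 1) (hs : 0 < s) (hc : 0 < c)
    (hsc : s ^ 2 + c ^ 2 = 1) : locusX h c s = locusX h s c := by
  have hp := sideRatio_pos h0 h1 hs hc hsc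
  rw [locusX, locusX, normAbscissa, normAbscissa, sideRatio_swap h0 h1 hs hc hsc]
  field_simp
  ring

theorem locusY_swap (h0 : 0 < h) (h1 : h < 1) (hs : 0 < s) (hc : 0 < c)
    (hsc : s ^ 2 + c ^ 2 = 1) : locusY h c s = -locusY h s c := by
  have hp := sideRatio_pos h0 h1 hs hc hsc
  rw [locusY, locusY, sideRatio_swap h0 h1 hs hc hsc]
  field_simp
  ring

theorem normAbscissa_rel (h0 : 0 < h) (h1 : h < 1) (hs : 0 < s) (hc : 0 < c)
    (hsc : s ^ 2 + c ^ 2 = 1) :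
    sideRatio h s c * ((1 + s) * (1 - normAbscissa h s c * (1 + c)))
      = (1 + c) * (normAbscissa h s c * (1 + s) - 1) := by
  have hp := sideRatio_pos h0 h1 hs hc hsc
  rw [normAbscissa]
  field_simp
  ring

/-- A weighted mean of two numbers above `1 / 2`. As `h ^ 2 < 1 / 2`, this selects the increasing
branch of the quadratic in `ξ`. -/
theorem half_lt_normAbscissa (h0 : 0 < h) (h1 : h < 1) (hs : 0 < s) (hc : 0 < c)
    (hsc : s ^ 2 + c ^ 2 = 1) : 1 / 2 < normAbscissa h s c := by
  have hp := sideRatio_pos h0 h1 hs hc hsc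
  obtain ⟨hs1, hc1⟩ := lt_one_of_sq_add_sq hs hc hsc
  have e1 : 1 / 2 < 1 / (1 + s) := by apply one_div_lt_one_div_of_lt <;> linarith
  have e2 : 1 / 2 < 1 / (1 + c) := by apply one_div_lt_one_div_of_lt <;> linarith
  rw [normAbscissa, lt_div_iff₀ (by positivity), div_eq_mul_one_div (sideRatio h s c)]
  nlinarith

theorem normAbscissa_conic (hh : h ^ 2 = 1 - h) (h0 : 0 < h) (hs : 0 < s) (hc : 0 < c)
    (hsc : s ^ 2 + c ^ 2 = 1) :
    (normAbscissa h s c ^ 2 - 2 * h ^ 2 * normAbscissa h s c) * (1 + s + c) ^ 2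
      = 2 * h - 2 * h ^ 2 * (1 + s + c) := by
  have h1 : h < 1 := by nlinarith
  -- The conic was obtained by cancelling `s - c`, so the symmetric position `R = 1`, `s ^ 2 = 1 /
  -- 2` is checked directly.
  rcases eq_or_ne s c with rfl | hne
  · obtain ⟨hs1, -⟩ := lt_one_of_sq_add_sq hs hc hsc
    have e : normAbscissa h s s * (1 + s) = 1 := by
      rw [normAbscissa, sideRatio_self h1 hs hs1]
      field_simp
    have hne : (1 + s) ^ 2 ≠ 0 := by positivity
    apply mul_right_cancel₀ hne
    generalize normAbscissa h s s = ξ at e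
    have e2 : ξ ^ 2 * (1 + s) ^ 2 = 1 := by rw [← mul_pow, e, one_pow]
    have hs2 : s ^ 2 = 1 / 2 := by linarith
    linear_combination (1 + 2 * s) ^ 2 * e2 - 2 * h ^ 2 * (1 + 2 * s) ^ 2 * (1 + s) * e
      - (3 + 4 * s) * hh + (4 - 2 * h - 6 * h ^ 2 - 4 * h ^ 2 * s) * hs2
  · exact conic_of_ratio hh hc hsc hne (sideRatio_sq h0 h1 hs hc hsc)
      (normAbscissa_rel h0 h1 hs hc hsc)

end Locus

section Locus

variable {h w s c : ℝ}

/-- Two numbers above `h ^ 2` are compared by the values of the conic's quadratic. -/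
theorem le_of_quadratic_le {ξ η : ℝ} (hη : h ^ 2 < η)
    (hle : ξ ^ 2 - 2 * h ^ 2 * ξ ≤ η ^ 2 - 2 * h ^ 2 * η) : ξ ≤ η := by
  by_contra! hlt
  nlinarith [mul_pos (sub_pos.mpr hlt) (by linarith : 0 < ξ + η - 2 * h ^ 2)]

theorem normAbscissa_quadratic (hh : h ^ 2 = 1 - h) (h0 : 0 < h) (hs : 0 < s) (hc : 0 < c)
    (hsc : s ^ 2 + c ^ 2 = 1) {n : ℝ} (hn : n * (1 + s + c) = 1) :
    normAbscissa h s c ^ 2 - 2 * h ^ 2 * normAbscissa h s c = 2 * h * n ^ 2 - 2 * h ^ 2 * n := by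
  have hm : (1 + s + c) ^ 2 ≠ 0 := by positivity
  apply mul_right_cancel₀ hm
  rw [normAbscissa_conic hh h0 hs hc hsc]
  linear_combination (2 * h ^ 2 * (1 + s + c) - 2 * h * (n * (1 + s + c) + 1)) * hn

theorem add_bounds (hs : 0 < s) (hc : 0 < c) (hsc : s ^ 2 + c ^ 2 = 1) (hw : w ^ 2 = 2)
    (w0 : 0 < w) : 1 < s + c ∧ s + c ≤ w := by
  constructor <;> nlinarith [mul_pos hs hc, sq_nonneg (s - c)]

/-- As `1 < s + c ≤ √2`, `n` runs over `[√2 - 1, 1 / 2)`; this and the next identity give the points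
of the conic at the two ends. -/
theorem quadratic_lower (hh : h ^ 2 = 1 - h) (hw : w ^ 2 = 2) :
    (2 - w) ^ 2 - 2 * h ^ 2 * (2 - w) = 2 * h * (w - 1) ^ 2 - 2 * h ^ 2 * (w - 1) := by
  grind

theorem quadratic_upper (hh : h ^ 2 = 1 - h) (hw : w ^ 2 = 2) :
    (h ^ 2 + h ^ 2 * w / 2) ^ 2 - 2 * h ^ 2 * (h ^ 2 + h ^ 2 * w / 2)
      = 2 * h * (1 / 2) ^ 2 - 2 * h ^ 2 * (1 / 2) := by
  grind

theorem locusX_bounds (hh : h ^ 2 = 1 - h) (h0 : 0 < h) (hw : w ^ 2 = 2) (w0 : 0 < w)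
    (hs : 0 < s) (hc : 0 < c) (hsc : s ^ 2 + c ^ 2 = 1) :
    h * (2 * h + 1 - w) ≤ locusX h s c ∧ locusX h s c < h ^ 2 + h ^ 3 * w / 2 := by
  have h1 : h < 1 := by nlinarith
  obtain ⟨a, b⟩ := golden_bounds hh h0
  obtain ⟨c1, c2⟩ := sqrt_two_bounds hw w0
  obtain ⟨b1, b2⟩ := add_bounds hs hc hsc hw w0
  have hξ := half_lt_normAbscissa h0 h1 hs hc hsc
  have hm : 0 < 1 + s + c := by positivity
  set n := (1 + s + c)⁻¹ with hn
  have hnm : n * (1 + s + c) = 1 := inv_mul_cancel₀ hm.ne'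
  have hn1 : n < 1 / 2 := by nlinarith
  have hn2 : w - 1 ≤ n := by
    have : (w - 1) * (1 + s + c) ≤ 1 := by nlinarith
    nlinarith
  have hq := normAbscissa_quadratic hh h0 hs hc hsc hnm
  rw [locusX]
  constructor
  · have key : 2 - w ≤ normAbscissa h s c := by
      refine le_of_quadratic_le (h := h) (by linarith) ?_
      rw [hq, quadratic_lower hh hw]
      nlinarith [mul_nonneg (sub_nonneg.mpr hn2) (by linarith : 0 ≤ n + (w - 1) - h)]
    nlinarith
  · have key : normAbscissa h s c < h ^ 2 + h ^ 2 * w / 2 := by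
      by_contra! hle
      have hu : h ^ 2 < h ^ 2 + h ^ 2 * w / 2 := by
        have : 0 < h ^ 2 * w := by positivity
        linarith
      have : (normAbscissa h s c - (h ^ 2 + h ^ 2 * w / 2))
          * (normAbscissa h s c + (h ^ 2 + h ^ 2 * w / 2) - 2 * h ^ 2) < 0 := by
        have e := quadratic_upper hh hw
        have e2 : 2 * h * n ^ 2 - 2 * h ^ 2 * n < 2 * h * (1 / 2) ^ 2 - 2 * h ^ 2 * (1 / 2) := by
          have : 0 < (1 / 2 - n) * (1 / 2 + n - h) := mul_pos (by linarith) (by linarith)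
          nlinarith
        linarith
      have := mul_nonneg (sub_nonneg.mpr hle)
        (by linarith : 0 ≤ normAbscissa h s c + (h ^ 2 + h ^ 2 * w / 2) - 2 * h ^ 2)
      linarith
    have e : h ^ 2 + h ^ 3 * w / 2 = h * (2 * h - 1) + h * (h ^ 2 + h ^ 2 * w / 2) := by
      have h3 : h ^ 3 = 2 * h - 1 := by linear_combination (h - 1) * hh
      linear_combination -hh - h3
    rw [e]
    have := mul_lt_mul_of_pos_left key h0
    linarith

theorem locusX_self (hh : h ^ 2 = 1 - h) (h0 : 0 < h) (hw : w ^ 2 = 2) (w0 : 0 < w) (hs : 0 < s)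
    (hsc : s ^ 2 + s ^ 2 = 1) : locusX h s s = h * (2 * h + 1 - w) := by
  have h1 : h < 1 := by nlinarith
  have hs' : s = w / 2 := by
    rw [← sq_eq_sq₀ hs.le (by positivity)]; linarith
  rw [locusX, normAbscissa, sideRatio_self h1 hs (by nlinarith)]
  have : 1 / (1 + s) = 2 - w := by
    rw [div_eq_iff (by positivity), hs']; linear_combination hw / 2
  rw [this]
  ring

theorem locusY_self (h1 : h < 1) (hs : 0 < s) (hs1 : s < 1) : locusY h s s = 0 := by
  rw [locusY, sideRatio_self h1 hs hs1]
  field_simp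
  ring

/-- Strictness keeps the factor cancelled in the elimination away from zero. -/
theorem locusX_gt (hh : h ^ 2 = 1 - h) (h0 : 0 < h) (hw : w ^ 2 = 2) (w0 : 0 < w)
    (hs : 0 < s) (hc : 0 < c) (hsc : s ^ 2 + c ^ 2 = 1) (hne : s ≠ c) :
    h * (2 * h + 1 - w) < locusX h s c := by
  refine lt_of_le_of_ne (locusX_bounds hh h0 hw w0 hs hc hsc).1 fun heq => ?_
  have h1 : h < 1 := by nlinarith
  obtain ⟨a, b⟩ := golden_bounds hh h0
  obtain ⟨c1, c2⟩ := sqrt_two_bounds hw w0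
  have hξ : normAbscissa h s c = 2 - w := by
    apply mul_left_cancel₀ h0.ne'
    rw [locusX] at heq
    linarith
  have hlt : s + c < w := by nlinarith [mul_pos hs hc, sq_pos_of_ne_zero (sub_ne_zero.mpr hne)]
  have hm : 0 < 1 + s + c := by positivity
  set n := (1 + s + c)⁻¹ with hn
  have hnm : n * (1 + s + c) = 1 := inv_mul_cancel₀ hm.ne'
  have hn2 : w - 1 < n := by
    have : (w - 1) * (1 + s + c) < 1 := by nlinarith
    nlinarith
  have hq := normAbscissa_quadratic hh h0 hs hc hsc hnm
  rw [hξ, quadratic_lower hh hw] at hq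
  nlinarith [mul_pos (mul_pos h0 (sub_pos.mpr hn2)) (by linarith : 0 < n + (w - 1) - h)]

theorem conicK_eq (hh : h ^ 2 = 1 - h) (x : ℝ) :
    conicK h x = ((1 + h) * ((1 + h) * x - (2 * h - 1)) ^ 2
      - 2 * h * ((1 + h) * x - (2 * h - 1))) / 2 := by
  unfold conicK
  grind

theorem weighted_ordinate (hs : 0 < s) (hc : 0 < c) (hsc : s ^ 2 + c ^ 2 = 1) :
    (h * s / c - c / s * ((2 * h - 1) + 1 / (1 + s))) * (s * c)
      = (3 * h - 1) * s ^ 2 + s - 2 * h := by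
  field_simp
  have e : c ^ 2 = (1 - s) * (1 + s) := by linear_combination hsc
  rw [e]
  ring

theorem one_sub_two_mul_eq {n : ℝ} (hsc : s ^ 2 + c ^ 2 = 1) (hn : n * (1 + s + c) = 1) :
    1 - 2 * n = 2 * n ^ 2 * (s * c) := by
  linear_combination (-1 - n * (1 + s + c) + 2 * n) * hn + n ^ 2 * hsc

theorem sq_add_two_mul_sub_one_eq {n : ℝ} (hsc : s ^ 2 + c ^ 2 = 1)
    (hn : n * (1 + s + c) = 1) : n ^ 2 + 2 * n - 1 = n ^ 2 * (s - c) ^ 2 := by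
  linear_combination (1 + n * (1 + s + c) - 2 * n) * hn - 2 * n ^ 2 * hsc

/-- The right side is symmetric in `s` and `c`, hence a polynomial in `m = 1 + s + c` on the unit
circle, where `s c = (m² - 2 m) / 2`; the factor `n ^ 3` turns powers of `m` into powers of `n`. -/
theorem numerator_eq {n ξ : ℝ} (hsc : s ^ 2 + c ^ 2 = 1) (hn : n * (1 + s + c) = 1) :
    -4 * h * n ^ 3 + 2 * (1 - 2 * h) * n ^ 2 + (3 * h - 1) * (3 * n - 1) - ξ * (1 - (2 + h) * n)
      = 2 * n ^ 3 * (((3 * h - 1) * s ^ 2 + s - 2 * h) * (1 + s)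
        + ((3 * h - 1) * c ^ 2 + c - 2 * h) * (1 + c)
        - ξ * ((1 + s) * (1 + c)) * (((3 * h - 1) * s ^ 2 + s - 2 * h)
          + ((3 * h - 1) * c ^ 2 + c - 2 * h))) := by
  obtain ⟨m, hm⟩ : ∃ m, m = 1 + s + c := ⟨_, rfl⟩
  rw [← hm] at hn
  have hk : ((3 * h - 1) * s ^ 2 + s - 2 * h) + ((3 * h - 1) * c ^ 2 + c - 2 * h)
      = m - 2 - h := by
    rw [hm]; linear_combination (3 * h - 1) * hsc
  have hp : s * c = (m ^ 2 - 2 * m) / 2 := by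
    rw [hm]; linear_combination (-1 / 2) * hsc
  have hP : (1 + s) * (1 + c) = m ^ 2 / 2 := by
    linear_combination hp - hm
  have hsk : ((3 * h - 1) * s ^ 2 + s - 2 * h) * (1 + s)
        + ((3 * h - 1) * c ^ 2 + c - 2 * h) * (1 + c)
      = (m - 2 - h) + (3 * h - 1) * (m - 1) * (1 - s * c) + 1 - 2 * h * (m - 1) := by
    rw [← hk, hm]; linear_combination ((3 * h - 1) * (s + c) + 1) * hsc
  rw [hk, hP, hsk, hp]
  have h2 : n ^ 3 * m ^ 2 = n := by linear_combination n * (n * m + 1) * hn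
  have h1 : n ^ 3 * m = n ^ 2 := by linear_combination n ^ 2 * hn
  have h3 : n ^ 3 * m ^ 3 = 1 := by linear_combination (n ^ 2 * m ^ 2 + n * m + 1) * hn
  linear_combination (-2 + 4 * h) * h1 + (-3 * (3 * h - 1) - ξ * (2 + h)) * h2
    + ((3 * h - 1) + ξ) * h3

theorem locus_on_curve (hh : h ^ 2 = 1 - h) (h0 : 0 < h) (hw : w ^ 2 = 2) (w0 : 0 < w)
    (hs : 0 < s) (hc : 0 < c) (hsc : s ^ 2 + c ^ 2 = 1) :
    coeffA h (locusX h s c) * (locusY h s c ^ 2) ^ 2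
      + coeffB h (locusX h s c) * locusY h s c ^ 2 + coeffC h (locusX h s c) = 0 := by
  have h1 : h < 1 := by nlinarith
  obtain ⟨a, b⟩ := golden_bounds hh h0
  obtain ⟨hs1, hc1⟩ := lt_one_of_sq_add_sq hs hc hsc
  have hR := sideRatio_pos h0 h1 hs hc hsc
  have hx2 := (locusX_bounds hh h0 hw w0 hs hc hsc).2
  rcases eq_or_ne s c with rfl | hne
  · rw [locusY_self h1 hs hs1, locusX_self hh h0 hw w0 hs hsc, coeffC, factor_lower hh hw]
    ring
  have hm : 0 < 1 + s + c := by positivity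
  set n := (1 + s + c)⁻¹ with hn
  have hnm : n * (1 + s + c) = 1 := inv_mul_cancel₀ hm.ne'
  have hq := normAbscissa_quadratic hh h0 hs hc hsc hnm
  have hrel := normAbscissa_rel h0 h1 hs hc hsc
  have hxgt := locusX_gt hh h0 hw w0 hs hc hsc hne
  have hxξ : (1 + h) * locusX h s c - (2 * h - 1) = normAbscissa h s c := by
    rw [locusX]; linear_combination (normAbscissa h s c + (2 * h - 1)) * hh
  have hy : locusY h s c * (s * c) * (1 + sideRatio h s c)
      = ((3 * h - 1) * s ^ 2 + s - 2 * h)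
        - sideRatio h s c * ((3 * h - 1) * c ^ 2 + c - 2 * h) := by
    rw [locusY]
    rw [div_mul_eq_mul_div, div_mul_cancel₀ _ (by positivity), ← weighted_ordinate hs hc hsc,
      ← weighted_ordinate hc hs (by linarith)]
    ring
  have hord := ordinate_eq hrel hy
  apply coeff_eq_zero_of_conic (n := n) hh (by linarith)
  · rw [factor_lower hh hw]
    obtain ⟨l1, l2, l3, l4⟩ := line_bounds hh h0 hw w0
    have : 0 < h * w := by positivity
    exact mul_ne_zero (by linarith) (by linarith)
  · rw [conicK_eq hh, hxξ]
    linear_combination ((-1 - h) / 2) * hq - (n ^ 2 - h * n + h * normAbscissa h s c) * hh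
  · rw [hxξ, numerator_eq hsc hnm, ← hord, one_sub_two_mul_eq hsc hnm,
      sq_add_two_mul_sub_one_eq hsc hnm]
    ring

end Locus

/-! ### The locus fills the strip -/

section Locus

variable {h w s c x y : ℝ}

theorem sin_pos_cos_pos {α : ℝ} (hα : α ∈ Set.Ioo 0 (Real.pi / 2)) :
    0 < Real.sin α ∧ 0 < Real.cos α :=
  ⟨Real.sin_pos_of_pos_of_lt_pi hα.1 (by linarith [hα.2, Real.pi_pos]),
    Real.cos_pos_of_mem_Ioo ⟨by linarith [hα.1, Real.pi_pos], hα.2⟩⟩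

theorem continuousOn_locus (h0 : 0 < h) (h1 : h < 1) :
    ContinuousOn
      (fun α => (locusX h (Real.sin α) (Real.cos α), locusY h (Real.sin α) (Real.cos α)))
      (Set.Ioo 0 (Real.pi / 2)) := by
  have hcs : ∀ α ∈ Set.Ioo (0 : ℝ) (Real.pi / 2), (1 - h * Real.cos α) * (1 + Real.sin α) ≠ 0 := by
    intro α hα
    obtain ⟨hs, hc⟩ := sin_pos_cos_pos hα
    obtain ⟨-, hc1⟩ := lt_one_of_sq_add_sq hs hc (Real.sin_sq_add_cos_sq α)
    have := one_sub_mul_pos h0 h1 hc1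
    positivity
  have hR : ContinuousOn (fun α => sideRatio h (Real.sin α) (Real.cos α))
      (Set.Ioo 0 (Real.pi / 2)) := by
    unfold sideRatio
    exact (ContinuousOn.div (by fun_prop) (by fun_prop) hcs).sqrt
  have hs0 : ∀ α ∈ Set.Ioo (0 : ℝ) (Real.pi / 2), Real.sin α ≠ 0 :=
    fun α hα => (sin_pos_cos_pos hα).1.ne'
  have hc0 : ∀ α ∈ Set.Ioo (0 : ℝ) (Real.pi / 2), Real.cos α ≠ 0 :=
    fun α hα => (sin_pos_cos_pos hα).2.ne'
  have hs1 : ∀ α ∈ Set.Ioo (0 : ℝ) (Real.pi / 2), 1 + Real.sin α ≠ 0 :=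
    fun α hα => by linarith [(sin_pos_cos_pos hα).1]
  have hc1 : ∀ α ∈ Set.Ioo (0 : ℝ) (Real.pi / 2), 1 + Real.cos α ≠ 0 :=
    fun α hα => by linarith [(sin_pos_cos_pos hα).2]
  have hR1 : ∀ α ∈ Set.Ioo (0 : ℝ) (Real.pi / 2),
      1 + sideRatio h (Real.sin α) (Real.cos α) ≠ 0 := fun α _ => by
    have : 0 ≤ sideRatio h (Real.sin α) (Real.cos α) := Real.sqrt_nonneg _
    positivity
  have cs : ContinuousOn Real.sin (Set.Ioo 0 (Real.pi / 2)) := Real.continuous_sin.continuousOn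
  have cc : ContinuousOn Real.cos (Set.Ioo 0 (Real.pi / 2)) := Real.continuous_cos.continuousOn
  unfold locusX locusY normAbscissa
  refine ContinuousOn.prodMk ?_ ?_
  · fun_prop (disch := assumption)
  · fun_prop (disch := assumption)

/-- Every admissible abscissa is attained. -/
theorem exists_locusX_eq (hh : h ^ 2 = 1 - h) (h0 : 0 < h) (hw : w ^ 2 = 2) (w0 : 0 < w)
    (hx : h * (2 * h + 1 - w) ≤ x) (hx' : x < h ^ 2 + h ^ 3 * w / 2) :
    ∃ s c, 0 < s ∧ 0 < c ∧ s ^ 2 + c ^ 2 = 1 ∧ locusX h s c = x := by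
  have h1 : h < 1 := by nlinarith
  obtain ⟨a, b⟩ := golden_bounds hh h0
  obtain ⟨c1, c2⟩ := sqrt_two_bounds hw w0
  obtain ⟨ξ, rfl⟩ : ∃ ξ, x = h * (2 * h - 1) + h * ξ :=
    ⟨x / h - (2 * h - 1), by field_simp; ring⟩
  have hξ1 : 2 - w ≤ ξ := by
    apply le_of_mul_le_mul_left _ h0
    linarith
  have hξ2 : ξ < h ^ 2 + h ^ 2 * w / 2 := by
    apply lt_of_mul_lt_mul_left _ h0.le
    have h3 : h ^ 3 = 2 * h - 1 := by linear_combination (h - 1) * hh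
    nlinarith
  have hl := quadratic_lower hh hw
  have hu := quadratic_upper hh hw
  have hwpos : 0 < h ^ 2 * w := by positivity
  set g : ℝ → ℝ := fun α => 2 * h * (1 + Real.sin α + Real.cos α)⁻¹ ^ 2
    - 2 * h ^ 2 * (1 + Real.sin α + Real.cos α)⁻¹ with hg
  have hpi := Real.pi_pos
  have hsn : ∀ α ∈ Set.Icc 0 (Real.pi / 4), 0 ≤ Real.sin α := fun α hα =>
    Real.sin_nonneg_of_nonneg_of_le_pi hα.1 (by linarith [hα.2])
  have hcp : ∀ α ∈ Set.Icc 0 (Real.pi / 4), 0 < Real.cos α := fun α hα =>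
    Real.cos_pos_of_mem_Ioo ⟨by linarith [hα.1], by linarith [hα.2]⟩
  have hcont : ContinuousOn g (Set.Icc 0 (Real.pi / 4)) := by
    have hne : ∀ α ∈ Set.Icc 0 (Real.pi / 4), 1 + Real.sin α + Real.cos α ≠ 0 := fun α hα => by
      linarith [hsn α hα, hcp α hα]
    have : ContinuousOn (fun α => (1 + Real.sin α + Real.cos α)⁻¹) (Set.Icc 0 (Real.pi / 4)) :=
      ContinuousOn.inv₀ (by fun_prop) hne
    rw [hg]
    fun_prop
  have hg0 : g 0 = 2 * h * (1 / 2) ^ 2 - 2 * h ^ 2 * (1 / 2) := by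
    simp only [hg, Real.sin_zero, Real.cos_zero]
    norm_num
  have hg1 : g (Real.pi / 4) = 2 * h * (w - 1) ^ 2 - 2 * h ^ 2 * (w - 1) := by
    have h2 : √2 = w := by rw [← hw, Real.sqrt_sq w0.le]
    have : (1 + w / 2 + w / 2)⁻¹ = w - 1 := by
      apply inv_eq_of_mul_eq_one_right
      linear_combination hw
    simp only [hg, Real.sin_pi_div_four, Real.cos_pi_div_four, h2, this]
  -- The intermediate value theorem is applied to the conic's right side as a function of `α`. Since
  -- the quadratic in `ξ` is injective above `h ^ 2`, matching its value recovers the abscissa.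
  obtain ⟨α, hα, hαg⟩ : ξ ^ 2 - 2 * h ^ 2 * ξ ∈ g '' Set.Icc 0 (Real.pi / 4) := by
    apply intermediate_value_Icc' (by positivity) hcont
    rw [hg0, hg1, ← hl, ← hu]
    constructor
    · nlinarith [mul_nonneg (sub_nonneg.mpr hξ1) (by linarith : 0 ≤ ξ + (2 - w) - 2 * h ^ 2)]
    · nlinarith [mul_nonneg (sub_nonneg.mpr hξ2.le)
        (by linarith : 0 ≤ ξ + (h ^ 2 + h ^ 2 * w / 2) - 2 * h ^ 2)]
  have hα0 : 0 < α := by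
    refine lt_of_le_of_ne hα.1 fun h0' => ?_
    rw [← h0', hg0, ← hu] at hαg
    nlinarith [mul_pos (sub_pos.mpr hξ2)
        (by linarith : 0 < ξ + (h ^ 2 + h ^ 2 * w / 2) - 2 * h ^ 2)]
  obtain ⟨hs, hc⟩ := sin_pos_cos_pos (α := α) ⟨hα0, by linarith [hα.2]⟩
  have hsc := Real.sin_sq_add_cos_sq α
  refine ⟨Real.sin α, Real.cos α, hs, hc, hsc, ?_⟩
  have hq := normAbscissa_quadratic hh h0 hs hc hsc
    (inv_mul_cancel₀ (by positivity : (1 + Real.sin α + Real.cos α) ≠ 0))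
  have hhalf := half_lt_normAbscissa h0 h1 hs hc hsc
  have e : normAbscissa h (Real.sin α) (Real.cos α) = ξ := by
    apply le_antisymm <;> apply le_of_quadratic_le (h := h) (by linarith)
    · exact (hq.trans hαg).le
    · exact (hq.trans hαg).ge
  rw [locusX, e]

/-- The part of the curve in the strip is the parametrised locus. -/
theorem exists_locus_eq_of_mem_strip (hh : h ^ 2 = 1 - h) (h0 : 0 < h) (hw : w ^ 2 = 2) (w0 : 0 < w)
    (hx : 1 / 2 ≤ x) (hx' : x ≤ h ^ 2 + h ^ 3 * w / 2)
    (hF : coeffA h x * (y ^ 2) ^ 2 + coeffB h x * y ^ 2 + coeffC h x = 0) :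
    ∃ s c, 0 < s ∧ 0 < c ∧ s ^ 2 + c ^ 2 = 1 ∧ locusX h s c = x ∧ locusY h s c = y := by
  have h1 : h < 1 := by nlinarith
  obtain ⟨b1, b2⟩ := strip_bounds hh h0 hw w0 hx hx' (sq_nonneg y) hF
  obtain ⟨s, c, hs, hc, hsc, rfl⟩ := exists_locusX_eq hh h0 hw w0 b1 b2
  have hF' := locus_on_curve hh h0 hw w0 hs hc hsc
  have := strip_unique hh h0 hw w0 b1 b2 (sq_nonneg _) (sq_nonneg _) hF' hF
  rcases sq_eq_sq_iff_eq_or_eq_neg.mp this with hy | hy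
  · exact ⟨s, c, hs, hc, hsc, rfl, hy⟩
  -- The wrong sign of the ordinate is repaired by reflection, that is by exchanging `s` and `c`.
  · refine ⟨c, s, hc, hs, by linarith, locusX_swap h0 h1 hs hc hsc, ?_⟩
    rw [locusY_swap h0 h1 hs hc hsc, hy, neg_neg]

end Locus

/-! ### The locus as a connected component -/

/-- The locus of the centroid in parametrised form. -/
def paramLocus (f h : ℝ) : Set Plane :=
  {p | ∃ s c, 0 < s ∧ 0 < c ∧ s ^ 2 + c ^ 2 = 1 ∧
    p = !₂[f * locusX h s c, f * locusY h s c]}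

theorem isPreconnected_paramLocus {f h : ℝ} (h0 : 0 < h) (h1 : h < 1) :
    IsPreconnected (paramLocus f h) := by
  have hc := continuousOn_locus h0 h1
  have : paramLocus f h = (fun α => (!₂[f * locusX h (Real.sin α) (Real.cos α),
      f * locusY h (Real.sin α) (Real.cos α)] : Plane)) '' Set.Ioo 0 (Real.pi / 2) := by
    ext p
    constructor
    · rintro ⟨s, c, hs, hc, hsc, rfl⟩
      obtain ⟨hs1, -⟩ := lt_one_of_sq_add_sq hs hc hsc
      have e1 : Real.sin (Real.arcsin s) = s := Real.sin_arcsin (by linarith) hs1.le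
      have e2 : Real.cos (Real.arcsin s) = c := by
        rw [Real.cos_arcsin, ← Real.sqrt_sq hc.le]
        congr 1; linarith
      refine ⟨Real.arcsin s, ⟨Real.arcsin_pos.mpr hs, Real.arcsin_lt_pi_div_two.mpr hs1⟩, ?_⟩
      simp only [e1, e2]
    · rintro ⟨α, hα, rfl⟩
      obtain ⟨hs, hc⟩ := sin_pos_cos_pos hα
      exact ⟨_, _, hs, hc, Real.sin_sq_add_cos_sq α, rfl⟩
  rw [this]
  apply isPreconnected_Ioo.image
  apply (PiLp.continuous_toLp 2 _).comp_continuousOn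
  rw [continuousOn_pi]
  intro i
  fin_cases i
  · exact (continuous_const.mul continuous_fst).comp_continuousOn hc
  · exact (continuous_const.mul continuous_snd).comp_continuousOn hc

theorem paramLocus_nonempty (f h : ℝ) : (paramLocus f h).Nonempty := by
  obtain ⟨hs, hc⟩ := sin_pos_cos_pos (α := Real.pi / 4)
    ⟨by linarith [Real.pi_pos], by linarith [Real.pi_pos]⟩
  exact ⟨_, _, _, hs, hc, Real.sin_sq_add_cos_sq _, rfl⟩

theorem paramLocus_eq_component {f h w : ℝ} (hf : 0 < f) (hh : h ^ 2 = 1 - h) (h0 : 0 < h)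
    (h5 : √5 = 2 * h + 1) (hw : w ^ 2 = 2) (w0 : 0 < w) :
    ∃ p ∈ curve f, paramLocus f h = connectedComponentIn (curve f) p := by
  have h1 : h < 1 := by nlinarith
  obtain ⟨l1, l2, l3, l4⟩ := line_bounds hh h0 hw w0
  set lo := h * (2 * h + 1 - w) with hlo
  set up := h ^ 2 + h ^ 3 * w / 2 with hup
  have hsub : paramLocus f h ⊆ curve f := by
    rintro _ ⟨s, c, hs, hc, hsc, rfl⟩
    have := eval_curvePoly (f := f) hh h5
      (fun i => (!₂[f * locusX h s c, f * locusY h s c] : Plane) i)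
      (locusX h s c) (locusY h s c) (by simp) (by simp)
    rw [locus_on_curve hh h0 hw w0 hs hc hsc, mul_zero] at this
    exact this
  have hstrip : ∀ q ∈ curve f, 1 / 2 * f ≤ q 0 → q 0 ≤ up * f → q ∈ paramLocus f h := by
    intro q hq hq0 hq1
    have e0 : q 0 = f * (q 0 / f) := by field_simp
    have e1 : q 1 = f * (q 1 / f) := by field_simp
    have := eval_curvePoly (f := f) hh h5 (fun i => q i) _ _ e0 e1
    rw [show MvPolynomial.eval (fun i => q i) (curvePoly f) = 0 from hq, eq_comm, mul_eq_zero,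
      or_iff_right (by positivity)] at this
    obtain ⟨s, c, hs, hc, hsc, hX, hY⟩ := exists_locus_eq_of_mem_strip hh h0 hw w0
      ((le_div_iff₀ hf).mpr hq0) ((div_le_iff₀ hf).mpr hq1) this
    refine ⟨s, c, hs, hc, hsc, ?_⟩
    rw [hX, hY, ← e0, ← e1]
    ext i; fin_cases i <;> rfl
  have hloc : ∀ q ∈ paramLocus f h, 1 / 2 * f < q 0 ∧ q 0 < up * f := by
    rintro _ ⟨s, c, hs, hc, hsc, rfl⟩
    obtain ⟨b1, b2⟩ := locusX_bounds hh h0 hw w0 hs hc hsc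
    have : lo ≤ locusX h s c := b1
    show 1 / 2 * f < f * locusX h s c ∧ f * locusX h s c < up * f
    constructor <;> nlinarith
  obtain ⟨p, hp⟩ := paramLocus_nonempty f h
  refine ⟨p, hsub hp, Set.Subset.antisymm
    ((isPreconnected_paramLocus h0 h1).subset_connectedComponentIn hp hsub) ?_⟩
  have hcont : Continuous fun q : Plane => q 0 := by fun_prop
  have hU : IsOpen {q : Plane | 1 / 2 * f < q 0 ∧ q 0 < up * f} :=
    (isOpen_lt continuous_const hcont).inter (isOpen_lt hcont continuous_const)
  have hV : IsOpen {q : Plane | q 0 < 1 / 2 * f ∨ up * f < q 0} :=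
    (isOpen_lt hcont continuous_const).union (isOpen_lt continuous_const hcont)
  have hCsub := connectedComponentIn_subset (curve f) p
  -- The open strip and the open exterior of the closed strip cover the curve, because no point of
  -- it lies on either edge; the component of `p` therefore stays in the strip.
  have key := (isPreconnected_connectedComponentIn (F := curve f)
    (x := p)).subset_left_of_subset_union hU hV ?_ ?_ ⟨p, mem_connectedComponentIn (hsub hp), hloc p hp⟩
  · intro q hq
    exact hstrip q (hCsub hq) (key hq).1.le (key hq).2.le
  · rw [Set.disjoint_left]
    rintro q ⟨q1, q2⟩ (q3 | q3) <;> linarith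
  · intro q hq
    by_cases hin : 1 / 2 * f ≤ q 0 ∧ q 0 ≤ up * f
    · exact Or.inl (hloc q (hstrip q (hCsub hq) hin.1 hin.2))
    · right
      show q 0 < 1 / 2 * f ∨ up * f < q 0
      by_contra! hcon
      exact hin hcon

/-! ### Tangent chords and closed chains of four -/

/-- The point of the parabola `y² = -4 f x` with parameter `t`. -/
def parabolaPoint (f t : ℝ) : Plane := !₂[-f * t ^ 2, 2 * f * t]

@[simp] theorem parabolaPoint_zero (f t : ℝ) : parabolaPoint f t 0 = -f * t ^ 2 := rfl

@[simp] theorem parabolaPoint_one (f t : ℝ) : parabolaPoint f t 1 = 2 * f * t := rfl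

theorem parabolaPoint_mem (f t : ℝ) : parabolaPoint f t ∈ parabola f := by
  show (2 * f * t) ^ 2 = -4 * f * (-f * t ^ 2)
  ring

theorem eq_parabolaPoint {f : ℝ} (hf : f ≠ 0) {p : Plane} (hp : p ∈ parabola f) :
    p = parabolaPoint f (p 1 / (2 * f)) := by
  have hp' : p 1 ^ 2 = -4 * f * p 0 := hp
  ext i
  fin_cases i
  · show p 0 = -f * (p 1 / (2 * f)) ^ 2
    field_simp
    linear_combination hp'
  · show p 1 = 2 * f * (p 1 / (2 * f))
    field_simp

theorem parabolaPoint_injective {f : ℝ} (hf : f ≠ 0) : Function.Injective (parabolaPoint f) := by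
  intro s t h
  have : 2 * f * s = 2 * f * t := congrArg (fun p : Plane => p 1) h
  exact mul_left_cancel₀ (by positivity) this

/-- Tangency of a segment to the focal circle in coordinates. -/
theorem sideTangent_iff {f r : ℝ} (hr : 0 < r) (a b : Plane) :
    SideTangent (focalCircle f r) a b ↔ ∃ k : ℝ, 0 ≤ k ∧ k ≤ 1 ∧
      ∃ x y : ℝ, x = a 0 + k * (b 0 - a 0) ∧ y = a 1 + k * (b 1 - a 1) ∧
      (x + f) ^ 2 + y ^ 2 = r ^ 2 ∧ (a 0 - x) * (x + f) + (a 1 - y) * y = 0 ∧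
      (b 0 - x) * (x + f) + (b 1 - y) * y = 0 := by
  have hmem : ∀ T : Plane, T ∈ focalCircle f r ↔ (T 0 + f) ^ 2 + T 1 ^ 2 = r ^ 2 := by
    intro T
    rw [mem_sphere, focalCircle, ← sq_eq_sq₀ dist_nonneg hr.le, EuclideanSpace.dist_eq,
      Real.sq_sqrt (by positivity), Fin.sum_univ_two, Real.dist_eq, Real.dist_eq, sq_abs, sq_abs]
    simp [focus]
  have horth : ∀ T c : Plane, c ∈ (focalCircle f r).orthRadius T ↔
      (c 0 - T 0) * (T 0 + f) + (c 1 - T 1) * T 1 = 0 := by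
    intro T c
    rw [Sphere.mem_orthRadius_iff_inner_left]
    simp [focalCircle, focus, PiLp.inner_apply, Fin.sum_univ_two, mul_comm]
  constructor
  · rintro ⟨T, hT, h⟩
    rw [segment_eq_image'] at hT
    obtain ⟨k, hk, rfl⟩ := hT
    refine ⟨k, hk.1, hk.2, _, _, rfl, rfl, (hmem _).mp h.mem_sphere, ?_, ?_⟩
    · exact (horth _ _).mp (h.le_orthRadius (left_mem_affineSpan_pair ℝ a b))
    · exact (horth _ _).mp (h.le_orthRadius (right_mem_affineSpan_pair ℝ a b))
  · rintro ⟨k, hk0, hk1, x, y, hx, hy, hc, ha, hb⟩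
    have hT : a + k • (b - a) ∈ segment ℝ a b := by
      rw [segment_eq_image']
      exact ⟨k, ⟨hk0, hk1⟩, rfl⟩
    have e0 : (a + k • (b - a)) 0 = x := hx.symm
    have e1 : (a + k • (b - a)) 1 = y := hy.symm
    refine ⟨_, hT, ?_, ?_, ?_⟩
    · rw [hmem, e0, e1, hc]
    · exact (mem_segment_iff_wbtw.mp hT).mem_affineSpan
    · rw [affineSpan_le]
      rintro c (rfl | rfl)
      · exact (horth _ _).mpr (by rw [e0, e1, ha])
      · exact (horth _ _).mpr (by rw [e0, e1, hb])

section Chords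

variable {f r ρ s t : ℝ}

theorem chord_of_sideTangent (hf : 0 < f) (hr : 0 < r) (hρ : r ^ 2 = 4 * ρ * f ^ 2) (hne : s ≠ t)
    (h : SideTangent (focalCircle f r) (parabolaPoint f s) (parabolaPoint f t)) :
    (1 + s * t) ^ 2 = ρ * (4 + (s + t) ^ 2) ∧ (ρ = 1 → 1 + s * t ≤ 0) := by
  obtain ⟨k, hk0, hk1, x, y, hx, hy, hc, ha, hb⟩ := (sideTangent_iff hr _ _).mp h
  simp only [parabolaPoint_zero, parabolaPoint_one] at hx hy ha hb
  have h1 : (s + t) * (x + f) = 2 * y := by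
    apply mul_left_cancel₀ (mul_ne_zero hf.ne' (sub_ne_zero.mpr hne))
    linear_combination hb - ha
  have h2 : 2 * x + (s + t) * y = 2 * s * t * f := by rw [hx, hy]; ring
  have h3 : (x + f) * (4 + (s + t) ^ 2) = 4 * f * (1 + s * t) := by
    linear_combination (s + t) * h1 + 2 * h2
  have h4 : (x + f) ^ 2 * (4 + (s + t) ^ 2) = 16 * ρ * f ^ 2 := by
    linear_combination 4 * hc + 4 * hρ + ((s + t) * (x + f) + 2 * y) * h1
  constructor
  · apply mul_left_cancel₀ (by positivity : 16 * f ^ 2 ≠ 0)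
    linear_combination (4 + (s + t) ^ 2) * h4
      - ((x + f) * (4 + (s + t) ^ 2) + 4 * f * (1 + s * t)) * h3
  -- Here `r = 2 f`. A contact point within the segment satisfies `y² + 4 f x ≤ 0`, so `(f - x)² ≥ 4
  -- f²` on the circle. Hence `x ≤ -f`, and `1 + s t` has the sign of `x + f`.
  · rintro rfl
    have h5 : y ^ 2 + 4 * f * x = -(4 * f ^ 2 * (k * (1 - k) * (s - t) ^ 2)) := by
      rw [hx, hy]; ring
    have h6 : 0 ≤ 4 * f ^ 2 * (k * (1 - k) * (s - t) ^ 2) := by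
      have := sub_nonneg.mpr hk1
      positivity
    have h7 : x ≤ f := by nlinarith [sq_nonneg y]
    have h8 : (2 * f) ^ 2 ≤ (f - x) ^ 2 := by nlinarith
    have h9 : 2 * f ≤ f - x := abs_le_of_sq_le_sq' h8 (by linarith) |>.2
    have h10 : 4 * f * (1 + s * t) ≤ 0 := by
      rw [← h3]
      exact mul_nonpos_of_nonpos_of_nonneg (by linarith) (by positivity)
    by_contra! hpos
    have : 0 < 4 * f * (1 + s * t) := by positivity
    linarith

/-- The bound on `ρ` means `r < f`, so the circle lies inside the parabola and the contact point of
the line falls between the ends of the chord. -/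
theorem sideTangent_of_chord (hf : 0 < f) (hr : 0 < r) (hρ : r ^ 2 = 4 * ρ * f ^ 2)
    (hρ' : ρ < 1 / 4) (hne : s ≠ t) (h : (1 + s * t) ^ 2 = ρ * (4 + (s + t) ^ 2)) :
    SideTangent (focalCircle f r) (parabolaPoint f s) (parabolaPoint f t) := by
  have hd : 0 < 4 + (s + t) ^ 2 := by positivity
  have hts : t - s ≠ 0 := sub_ne_zero.mpr hne.symm
  obtain ⟨z, hz⟩ : ∃ z, z * (4 + (s + t) ^ 2) = 4 * f * (1 + s * t) :=
    ⟨4 * f * (1 + s * t) / (4 + (s + t) ^ 2), div_mul_cancel₀ _ hd.ne'⟩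
  obtain ⟨k, hk⟩ : ∃ k, k * (2 * f * (t - s)) = (s + t) * z / 2 - 2 * f * s :=
    ⟨((s + t) * z / 2 - 2 * f * s) / (2 * f * (t - s)), div_mul_cancel₀ _ (by positivity)⟩
  have hx : z - f = -f * s ^ 2 + k * (-f * t ^ 2 - -f * s ^ 2) := by
    linear_combination (1 / 4) * hz + (s + t) / 2 * hk
  have hy : (s + t) * z / 2 = 2 * f * s + k * (2 * f * t - 2 * f * s) := by
    linear_combination -hk
  have hc : z ^ 2 + ((s + t) * z / 2) ^ 2 = r ^ 2 := by
    apply mul_right_cancel₀ hd.ne'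
    rw [hρ]
    linear_combination (z * (4 + (s + t) ^ 2) / 4 + f * (1 + s * t)) * hz + 4 * f ^ 2 * h
  have hin : ((s + t) * z / 2) ^ 2 + 4 * f * (z - f) =
      -(4 * f ^ 2 * (s - t) ^ 2 * (k * (1 - k))) := by
    rw [hx, hy]; ring
  have hneg : ((s + t) * z / 2) ^ 2 + 4 * f * (z - f) ≤ 0 := by
    have h1 : z ^ 2 ≤ f ^ 2 := by nlinarith [sq_nonneg ((s + t) * z / 2), sq_nonneg f]
    have h2 : z ≤ f := abs_le_of_sq_le_sq' h1 hf.le |>.2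
    nlinarith [sq_nonneg f, sq_nonneg z]
  have hk2 : 0 ≤ k * (1 - k) := by
    by_contra! hlt
    have : 0 < 4 * f ^ 2 * (s - t) ^ 2 := by
      have := sub_ne_zero.mpr hne
      positivity
    nlinarith
  refine (sideTangent_iff hr _ _).mpr ⟨k, by nlinarith, by nlinarith, z - f, (s + t) * z / 2,
    hx, hy, by rw [sub_add_cancel]; exact hc, ?_, ?_⟩
  · simp only [parabolaPoint_zero, parabolaPoint_one]
    linear_combination (-z / 4) * hz
  · simp only [parabolaPoint_zero, parabolaPoint_one]
    linear_combination (-z / 4) * hz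

/-- Sum and product relation for the two tangent chords from a vertex. -/
theorem chord_pair {s a b : ℝ} (hab : a ≠ b) (ha : (1 + s * a) ^ 2 = ρ * (4 + (s + a) ^ 2))
    (hb : (1 + s * b) ^ 2 = ρ * (4 + (s + b) ^ 2)) :
    (s ^ 2 - ρ) * (a + b) + 2 * (1 - ρ) * s = 0 ∧
      s ^ 2 * (a * b + ρ) = 1 - 4 * ρ + ρ * (a * b) := by
  have h1 : (s ^ 2 - ρ) * (a + b) + 2 * (1 - ρ) * s = 0 := by
    apply mul_left_cancel₀ (sub_ne_zero.mpr hab)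
    linear_combination ha - hb
  exact ⟨h1, by linear_combination a * h1 - ha⟩

theorem eq_neg_of_sq_eq (hne : s ≠ t) (h : s ^ 2 = t ^ 2) : t = -s ∧ s ≠ 0 := by
  rcases sq_eq_sq_iff_eq_or_eq_neg.mp h with h | h
  · exact absurd h hne
  · refine ⟨by linarith, fun h0 => hne ?_⟩
    linarith

/-- A closed chain of four tangent chords exists only for two values of the radius. -/
theorem closed_chain {a b c d : ℝ} (hac : a ≠ c) (hbd : b ≠ d)
    (hab : (1 + a * b) ^ 2 = ρ * (4 + (a + b) ^ 2)) (hbc : (1 + b * c) ^ 2 = ρ * (4 + (b + c) ^ 2))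
    (hcd : (1 + c * d) ^ 2 = ρ * (4 + (c + d) ^ 2))
    (hda : (1 + d * a) ^ 2 = ρ * (4 + (d + a) ^ 2)) :
    (b * d = -ρ ∧ ρ ^ 2 + 4 * ρ = 1) ∨ (ρ = 1 ∧ c = -a) := by
  obtain ⟨a1, a2⟩ := chord_pair hbd hab (by linear_combination hda : (1 + a * d) ^ 2 = _)
  obtain ⟨c1, c2⟩ := chord_pair hbd (by linear_combination hbc : (1 + c * b) ^ 2 = _) hcd
  -- Opposite vertices `a` and `c` have the same neighbours, and the product relation sees the
  -- vertex only through its square.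
  have h : (a ^ 2 - c ^ 2) * (b * d + ρ) = 0 := by linear_combination a2 - c2
  rcases mul_eq_zero.mp h with h | h
  · obtain ⟨h1, h2⟩ := eq_neg_of_sq_eq hac (sub_eq_zero.mp h)
    refine Or.inr ⟨?_, h1⟩
    rw [h1] at c1
    have : a * (1 - ρ) = 0 := by linear_combination (a1 - c1) / 4
    linarith [(mul_eq_zero.mp this).resolve_left h2]
  · have hbd' : b * d = -ρ := by linarith
    refine Or.inl ⟨hbd', ?_⟩
    rw [hbd'] at a2
    linarith

theorem sum_mul_sum {a b c d : ℝ} (hρ0 : ρ ≠ 0) (hbd : b ≠ d)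
    (hab : (1 + a * b) ^ 2 = ρ * (4 + (a + b) ^ 2))
    (hda : (1 + d * a) ^ 2 = ρ * (4 + (d + a) ^ 2)) (hac : a * c = -ρ) :
    (a + c) * (b + d) = -(2 * (1 - ρ)) := by
  obtain ⟨a1, -⟩ := chord_pair hbd hab (by linear_combination hda : (1 + a * d) ^ 2 = _)
  have ha : a ≠ 0 := by
    rintro rfl
    exact hρ0 (by linarith)
  apply mul_left_cancel₀ ha
  linear_combination a1 + (b + d) * hac

/-- The converse that produces a one-parameter family: the hypotheses are invariant under cyclic
relabelling, so all four sides follow from this one. -/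
theorem chord_of_products {a b c d : ℝ} (hρ : ρ ^ 2 + 4 * ρ = 1) (hac : a * c = -ρ)
    (hbd : b * d = -ρ) (huv : (a + c) * (b + d) = -(2 * (1 - ρ))) :
    (1 + a * b) ^ 2 = ρ * (4 + (a + b) ^ 2) := by
  linear_combination a * b * huv - a * (a + c) * hbd - (b ^ 2 - ρ) * hac - hρ

end Chords

/-! ### The polar quadrilateral and its perimeter centroid -/

/-- The pole of the chord joining the points with parameters `s` and `t`. -/
def chordPole (f s t : ℝ) : Plane := !₂[-f * (s * t), f * (s + t)]

@[simp] theorem chordPole_zero (f s t : ℝ) : chordPole f s t 0 = -f * (s * t) := rfl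

@[simp] theorem chordPole_one (f s t : ℝ) : chordPole f s t 1 = f * (s + t) := rfl

theorem mem_tangentLine_iff {f t : ℝ} (hf : f ≠ 0) (q : Plane) :
    q ∈ tangentLine f (parabolaPoint f t) ↔ q 0 = f * t ^ 2 - t * q 1 := by
  show 2 * f * t * q 1 = -2 * f * (q 0 + -f * t ^ 2) ↔ _
  constructor
  · intro h
    apply mul_left_cancel₀ (mul_ne_zero two_ne_zero hf)
    linear_combination h
  · intro h
    rw [h]; ring

theorem mem_tangentLines_iff {f s t : ℝ} (hf : f ≠ 0) (hne : s ≠ t) (q : Plane) :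
    q ∈ tangentLine f (parabolaPoint f s) ∩ tangentLine f (parabolaPoint f t)
      ↔ q = chordPole f s t := by
  rw [Set.mem_inter_iff, mem_tangentLine_iff hf, mem_tangentLine_iff hf]
  constructor
  · rintro ⟨h1, h2⟩
    have h3 : q 1 = f * (s + t) := by
      apply mul_left_cancel₀ (sub_ne_zero.mpr hne)
      linear_combination h1 - h2
    ext i
    fin_cases i
    · show q 0 = -f * (s * t)
      rw [h1, h3]; ring
    · exact h3
  · rintro rfl
    simp only [chordPole_zero, chordPole_one]
    constructor <;> ring

theorem dist_chordPole {f : ℝ} (hf : 0 < f) (s t u : ℝ) :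
    dist (chordPole f s t) (chordPole f t u) = f * (|s - u| * √(1 + t ^ 2)) := by
  rw [EuclideanSpace.dist_eq, Fin.sum_univ_two, Real.dist_eq, Real.dist_eq, sq_abs, sq_abs,
    ← Real.sqrt_sq_eq_abs, ← Real.sqrt_mul (sq_nonneg _)]
  have e : ∀ z, f * √z = √(f ^ 2 * z) := fun z => by
    rw [Real.sqrt_mul (sq_nonneg _), Real.sqrt_sq hf.le]
  rw [e]
  congr 1
  simp only [chordPole_zero, chordPole_one]
  ring

/-- Total length `√(1 + s²) + √(1 + t²)` attached to a pair of opposite vertices. -/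
def pairSum (s t : ℝ) : ℝ := √(1 + s ^ 2) + √(1 + t ^ 2)

/-- First moment attached to a pair of opposite vertices. -/
def pairMoment (s t : ℝ) : ℝ := s * √(1 + s ^ 2) + t * √(1 + t ^ 2)

/-- The perimeter of the polar quadrilateral for `f = 1`. -/
def polarPerimeter (a b c d : ℝ) : ℝ := |a - c| * pairSum b d + |b - d| * pairSum a c

theorem polarPerimeter_swap (a b c d : ℝ) : polarPerimeter b c d a = polarPerimeter a b c d := by
  unfold polarPerimeter pairSum
  rw [abs_sub_comm c a]
  ring

/-- Abscissa of the perimeter centroid for `f = 1`. -/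
def centroidX (a b c d : ℝ) : ℝ :=
  -(|a - c| * (a + c) * pairMoment b d + |b - d| * (b + d) * pairMoment a c)
    / (2 * polarPerimeter a b c d)

/-- Ordinate of the perimeter centroid for `f = 1`. -/
def centroidY (a b c d : ℝ) : ℝ :=
  (|a - c| * (2 * pairMoment b d + (a + c) * pairSum b d)
    + |b - d| * (2 * pairMoment a c + (b + d) * pairSum a c)) / (2 * polarPerimeter a b c d)

theorem centroidX_swap (a b c d : ℝ) : centroidX b c d a = centroidX a b c d := by
  unfold centroidX
  rw [polarPerimeter_swap, abs_sub_comm c a]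
  unfold pairMoment
  ring

theorem centroidY_swap (a b c d : ℝ) : centroidY b c d a = centroidY a b c d := by
  unfold centroidY
  rw [polarPerimeter_swap, abs_sub_comm c a]
  unfold pairMoment pairSum
  ring

theorem pairSum_pos (s t : ℝ) : 0 < pairSum s t := by
  unfold pairSum
  positivity

theorem polarPerimeter_pos {a b c d : ℝ} (hac : a ≠ c) : 0 < polarPerimeter a b c d := by
  have h1 := abs_pos.mpr (sub_ne_zero.mpr hac)
  have h2 := pairSum_pos b d
  have h3 := pairSum_pos a c
  unfold polarPerimeter
  positivity

theorem perimeterCentroid_eq {f : ℝ} (hf : 0 < f) (t : Fin 4 → ℝ) (hne : t 0 ≠ t 2) :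
    perimeterCentroid (fun i => chordPole f (t i) (t (i + 1)))
      = !₂[f * centroidX (t 0) (t 1) (t 2) (t 3), f * centroidY (t 0) (t 1) (t 2) (t 3)] := by
  have hW := polarPerimeter_pos (b := t 1) (d := t 3) hne
  have e23 : (2 : Fin 4) + 1 = 3 := rfl
  have e30 : (3 : Fin 4) + 1 = 0 := rfl
  have e12 : (1 : Fin 4) + 1 = 2 := rfl
  have hsum : ∑ i, dist (chordPole f (t i) (t (i + 1))) (chordPole f (t (i + 1)) (t (i + 1 + 1)))
      = f * polarPerimeter (t 0) (t 1) (t 2) (t 3) := by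
    simp only [dist_chordPole hf, Fin.sum_univ_four, zero_add, e12, e23, e30]
    rw [abs_sub_comm (t 2) (t 0), abs_sub_comm (t 3) (t 1)]
    unfold polarPerimeter pairSum
    ring
  unfold perimeterCentroid
  rw [hsum]
  ext i
  have hmid : ∀ (p q : Plane) (i : Fin 2), (midpoint ℝ p q) i = (p i + q i) / 2 := by
    intro p q i
    rw [midpoint_eq_smul_add]
    simp
    ring
  fin_cases i
  · simp only [dist_chordPole hf, Fin.sum_univ_four, zero_add, e12, e23, e30, PiLp.smul_apply,
      PiLp.add_apply, hmid, smul_eq_mul, Fin.zero_eta, chordPole_zero]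
    rw [abs_sub_comm (t 2) (t 0), abs_sub_comm (t 3) (t 1)]
    show _ = f * centroidX (t 0) (t 1) (t 2) (t 3)
    unfold centroidX pairMoment
    field_simp
    ring
  · simp only [dist_chordPole hf, Fin.sum_univ_four, zero_add, e12, e23, e30, PiLp.smul_apply,
      PiLp.add_apply, hmid, smul_eq_mul, Fin.mk_one, chordPole_one]
    rw [abs_sub_comm (t 2) (t 0), abs_sub_comm (t 3) (t 1)]
    show _ = f * centroidY (t 0) (t 1) (t 2) (t 3)
    unfold centroidY pairMoment pairSum
    field_simp
    ring

/-- The elementary symmetric data of a pair of opposite vertices. -/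
theorem pair_relations {h s t w : ℝ} (hst : s * t = -(2 * h - 1))
    (hw : w ^ 2 = (s + t) ^ 2 + 4 * h ^ 2) (w0 : 0 < w) :
    pairSum s t ^ 2 = (w + 2 - 2 * h) * (w + 2 * h) ∧
    pairMoment s t * (w + 2 * h) = pairSum s t * ((s + t) * (w + 2 * h - 1)) ∧
    |s - t| ^ 2 = (w - (2 - 2 * h)) * (w + 2 - 2 * h) := by
  set a := √(1 + s ^ 2) with ha
  set b := √(1 + t ^ 2) with hb
  have ha2 : a ^ 2 = 1 + s ^ 2 := Real.sq_sqrt (by positivity)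
  have hb2 : b ^ 2 = 1 + t ^ 2 := Real.sq_sqrt (by positivity)
  -- `(1 + s²)(1 + t²) = (s + t)² + (1 - s t)²`, and the prescribed product makes `1 - s t = 2 h`.
  have hab : a * b = w := by
    rw [ha, hb, ← Real.sqrt_mul (by positivity), Real.sqrt_eq_iff_mul_self_eq_of_pos w0]
    linear_combination hw + (2 * h - s * t + 1) * hst
  have hS : pairSum s t ^ 2 = (w + 2 - 2 * h) * (w + 2 * h) := by
    have : pairSum s t = a + b := rfl
    rw [this]
    linear_combination ha2 + hb2 + 2 * hab - hw - 2 * hst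
  refine ⟨hS, ?_, ?_⟩
  · have hSp := pairSum_pos s t
    apply mul_left_cancel₀ hSp.ne'
    have hDS : pairSum s t * pairMoment s t = (s + t) * ((w + 2 * h - 1) * (w + 2 - 2 * h)) := by
      have e1 : pairSum s t = a + b := rfl
      have e2 : pairMoment s t = s * a + t * b := rfl
      rw [e1, e2]
      linear_combination s * ha2 + t * hb2 + (s + t) * hab - (s + t) * hw - 3 * (s + t) * hst
    linear_combination (w + 2 * h) * hDS - (s + t) * (w + 2 * h - 1) * hS
  · rw [sq_abs]
    linear_combination -hw - 4 * hst

/-- The centroid of the polar quadrilateral in parametrised form. -/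
theorem centroid_eq_locus {h a b c d σ κ : ℝ} (hh : h ^ 2 = 1 - h) (h0 : 0 < h)
    (hσ : 0 < σ) (hκ : 0 < κ) (hσκ : σ ^ 2 + κ ^ 2 = 1) (hac : a * c = -(2 * h - 1))
    (hbd : b * d = -(2 * h - 1)) (hu : a + c = 2 * h * σ / κ) (hv : b + d = -(2 * h * κ / σ)) :
    centroidX a b c d = locusX h σ κ ∧ centroidY a b c d = locusY h σ κ := by
  have h1 : h < 1 := by nlinarith
  obtain ⟨b1, b2⟩ := golden_bounds hh h0
  obtain ⟨hσ1, hκ1⟩ := lt_one_of_sq_add_sq hσ hκ hσκ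
  have g1 := one_sub_mul_pos h0 h1 hσ1
  have g2 := one_sub_mul_pos h0 h1 hκ1
  obtain ⟨S1, D1, L1⟩ := pair_relations (w := 2 * h / κ) hac
    (by rw [hu]; field_simp; linear_combination -4 * hσκ) (by positivity)
  obtain ⟨S2, D2, L2⟩ := pair_relations (w := 2 * h / σ) hbd
    (by rw [hv]; field_simp; linear_combination -4 * hσκ) (by positivity)
  have S1p := pairSum_pos a c
  have S2p := pairSum_pos b d
  have L1p : 0 < |a - c| := by
    rw [abs_pos, sub_ne_zero]
    rintro rfl
    nlinarith
  have L2p : 0 < |b - d| := by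
    rw [abs_pos, sub_ne_zero]
    rintro rfl
    nlinarith
  have M1 : pairMoment a c = pairSum a c * (σ / κ * ((2 * h - 1) + 1 / (1 + κ))) := by
    have : 2 * h / κ + 2 * h ≠ 0 := by positivity
    apply mul_right_cancel₀ this
    rw [D1, hu]
    field_simp
    ring
  have M2 : pairMoment b d = -(pairSum b d * (κ / σ * ((2 * h - 1) + 1 / (1 + σ)))) := by
    have : 2 * h / σ + 2 * h ≠ 0 := by positivity
    apply mul_right_cancel₀ this
    rw [D2, hv]
    field_simp
    ring
  -- Both ratios are positive, so it suffices to compare squares, where `pair_relations` makes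
  -- everything rational and the common factors cancel.
  have hR : |b - d| * pairSum a c = sideRatio h σ κ * (|a - c| * pairSum b d) := by
    rw [← div_eq_iff (by positivity)]
    apply eq_sideRatio h0 h1 hσ hκ hσκ (by positivity)
    have q1 : 2 * h / κ - (2 - 2 * h) = 2 * h * (1 - h * κ) / κ := by
      field_simp
      linear_combination κ * hh
    have q2 : 2 * h / σ - (2 - 2 * h) = 2 * h * (1 - h * σ) / σ := by
      field_simp
      linear_combination σ * hh
    have r1 : 0 < 2 * h / κ + 2 - 2 * h := by
      have : 0 < 2 * h / κ := by positivity
      linarith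
    have r2 : 0 < 2 * h / σ + 2 - 2 * h := by
      have : 0 < 2 * h / σ := by positivity
      linarith
    rw [div_pow, mul_pow, mul_pow, S1, S2, L1, L2, q1, q2]
    generalize 2 * h / κ + 2 - 2 * h = z₁ at *
    generalize 2 * h / σ + 2 - 2 * h = z₂ at *
    field_simp
  have hK : σ / κ * (κ / σ) = 1 := by field_simp
  have hRp := sideRatio_pos h0 h1 hσ hκ hσκ
  have hW : polarPerimeter a b c d = |a - c| * pairSum b d * (1 + sideRatio h σ κ) := by
    unfold polarPerimeter
    rw [hR]; ring
  constructor
  · have e : |a - c| * (a + c) * pairMoment b d + |b - d| * (b + d) * pairMoment a c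
        = -(|a - c| * pairSum b d) * (2 * h * ((2 * h - 1) + 1 / (1 + σ))
          + sideRatio h σ κ * (2 * h * ((2 * h - 1) + 1 / (1 + κ)))) := by
      rw [M1, M2, hu, hv]
      generalize (2 * h - 1) + 1 / (1 + σ) = E₁
      generalize (2 * h - 1) + 1 / (1 + κ) = E₂
      linear_combination (-(|a - c| * pairSum b d * (2 * h * E₁))
        - |b - d| * pairSum a c * (2 * h * E₂)) * hK - 2 * h * E₂ * hR
    rw [centroidX, e, hW, locusX, normAbscissa]
    field_simp
    ring
  · have e : |a - c| * (2 * pairMoment b d + (a + c) * pairSum b d)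
        + |b - d| * (2 * pairMoment a c + (b + d) * pairSum a c)
        = (|a - c| * pairSum b d) * (2 * (h * σ / κ - κ / σ * ((2 * h - 1) + 1 / (1 + σ)))
          + sideRatio h σ κ * (2 * (σ / κ * ((2 * h - 1) + 1 / (1 + κ)) - h * κ / σ))) := by
      rw [M1, M2, hu, hv]
      linear_combination (2 * (σ / κ * ((2 * h - 1) + 1 / (1 + κ))) - 2 * h * κ / σ) * hR
    rw [centroidY, e, hW, locusY]
    have : |a - c| * pairSum b d ≠ 0 := by positivity
    rw [div_eq_div_iff (by positivity) (by positivity)]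
    ring

/-! ### The family in parameters and the equality of the loci -/

theorem ponceletFamily_params {f r ρ : ℝ} (hf : 0 < f) (hr : 0 < r) (hρ : r ^ 2 = 4 * ρ * f ^ 2)
    {P : Fin 4 → Plane} (hP : P ∈ ponceletFamily f r) :
    ∃ t : Fin 4 → ℝ, Function.Injective t ∧ (P = fun i => parabolaPoint f (t i)) ∧
      ∀ i, (1 + t i * t (i + 1)) ^ 2 = ρ * (4 + (t i + t (i + 1)) ^ 2) ∧
        (ρ = 1 → 1 + t i * t (i + 1) ≤ 0) := by
  obtain ⟨hinj, hpar, htan⟩ := hP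
  have hPt : P = fun i => parabolaPoint f (P i 1 / (2 * f)) :=
    funext fun i => eq_parabolaPoint hf.ne' (hpar i)
  have htinj : Function.Injective fun i => P i 1 / (2 * f) := by
    intro i j hij
    apply hinj
    have hij' : P i 1 / (2 * f) = P j 1 / (2 * f) := hij
    rw [congrFun hPt i, congrFun hPt j, hij']
  refine ⟨fun i => P i 1 / (2 * f), htinj, hPt, fun i => ?_⟩
  have h := htan i
  rw [congrFun hPt i, congrFun hPt (i + 1)] at h
  refine chord_of_sideTangent hf hr hρ (htinj.ne ?_) h
  fin_cases i <;> decide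

theorem family_products {f r ρ : ℝ} (hf : 0 < f) (hr : 0 < r) (hρ : r ^ 2 = 4 * ρ * f ^ 2)
    {P : Fin 4 → Plane} (hP : P ∈ ponceletFamily f r) :
    ρ ^ 2 + 4 * ρ = 1 ∧ ∃ t : Fin 4 → ℝ, Function.Injective t ∧
      (P = fun i => parabolaPoint f (t i)) ∧ t 0 * t 2 = -ρ ∧ t 1 * t 3 = -ρ ∧
      (t 0 + t 2) * (t 1 + t 3) = -(2 * (1 - ρ)) := by
  obtain ⟨t, hinj, hPt, hch⟩ := ponceletFamily_params hf hr hρ hP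
  have c0 := hch 0
  have c1 := hch 1
  have c2 := hch 2
  have c3 := hch 3
  simp only [zero_add, show (1 : Fin 4) + 1 = 2 from rfl, show (2 : Fin 4) + 1 = 3 from rfl,
    show (3 : Fin 4) + 1 = 0 from rfl] at c0 c1 c2 c3
  have n02 : t 0 ≠ t 2 := hinj.ne (by decide)
  have n13 : t 1 ≠ t 3 := hinj.ne (by decide)
  rcases closed_chain n02 n13 c0.1 c1.1 c2.1 c3.1 with ⟨h13, hq⟩ | ⟨h1, h2⟩
  · refine ⟨hq, t, hinj, hPt, ?_⟩
    have hρ0 : ρ ≠ 0 := by rintro rfl; norm_num at hq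
    rcases closed_chain n13 n02.symm c1.1 c2.1 c3.1 c0.1 with ⟨h20, -⟩ | ⟨h1, -⟩
    · have h02 : t 0 * t 2 = -ρ := by linarith
      exact ⟨h02, h13, sum_mul_sum hρ0 n13 c0.1 c3.1 h02⟩
    · rw [h1] at hq; norm_num at hq
  -- For `ρ = 1` and `t 2 = -t 0`, the segment condition on two adjacent sides gives `1 + t 0 * t 1
  -- ≤ 0` and `1 - t 0 * t 1 ≤ 0`.
  · exfalso
    have e0 := c0.2 h1
    have e1 := c1.2 h1
    rw [h2] at e1
    linarith

theorem exists_angle {h u v : ℝ} (h0 : 0 < h) (hu : 0 < u) (huv : u * v = -(4 * h ^ 2)) :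
    ∃ σ κ, 0 < σ ∧ 0 < κ ∧ σ ^ 2 + κ ^ 2 = 1 ∧ u = 2 * h * σ / κ ∧ v = -(2 * h * κ / σ) := by
  have hp : 0 < u ^ 2 + 4 * h ^ 2 := by positivity
  have hs := Real.sqrt_pos.mpr hp
  have hs2 := Real.sq_sqrt hp.le
  refine ⟨u / √(u ^ 2 + 4 * h ^ 2), 2 * h / √(u ^ 2 + 4 * h ^ 2), by positivity, by positivity,
    ?_, ?_, ?_⟩
  · rw [div_pow, div_pow, hs2, ← add_div, div_eq_one_iff_eq hp.ne']
    ring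
  · field_simp
  · field_simp
    linear_combination huv

theorem polar_eq {f : ℝ} (hf : f ≠ 0) {t : Fin 4 → ℝ} (ht : Function.Injective t)
    (P' : Fin 4 → Plane) :
    IsPolar f (fun i => parabolaPoint f (t i)) P' ↔
      P' = fun i => chordPole f (t i) (t (i + 1)) := by
  have hne : ∀ i, t i ≠ t (i + 1) := fun i => ht.ne (by fin_cases i <;> decide)
  constructor
  · intro h
    exact funext fun i => (mem_tangentLines_iff hf (hne i) _).mp (h i)
  · rintro rfl i
    exact (mem_tangentLines_iff hf (hne i) _).mpr rfl

theorem polarPerimeterLocus_subset {f r h : ℝ} (hf : 0 < f) (hr : 0 < r) (hh : h ^ 2 = 1 - h)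
    (h0 : 0 < h) (hρ : r ^ 2 = 4 * (2 * h - 1) * f ^ 2) :
    polarPerimeterLocus f r ⊆ paramLocus f h := by
  rintro _ ⟨P, hP, P', hP', rfl⟩
  obtain ⟨-, t, hinj, rfl, h02, h13, huv⟩ := family_products hf hr hρ hP
  rw [polar_eq hf.ne' hinj] at hP'
  rw [hP', perimeterCentroid_eq hf t (hinj.ne (by decide))]
  have huv' : (t 0 + t 2) * (t 1 + t 3) = -(4 * h ^ 2) := by linear_combination huv + 4 * hh
  rcases lt_trichotomy (t 0 + t 2) 0 with hu | hu | hu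
  · have hv : 0 < t 1 + t 3 := by
      by_contra! hle
      have := mul_nonneg_of_nonpos_of_nonpos hu.le hle
      have : 0 < h ^ 2 := by positivity
      linarith
    -- Shifting the labels by one makes the first opposite sum positive and does not change the
    -- centroid.
    obtain ⟨σ, κ, hσ, hκ, hσκ, e1, e2⟩ := exists_angle (v := t 2 + t 0) h0 hv
      (by linear_combination huv')
    obtain ⟨eX, eY⟩ := centroid_eq_locus hh h0 hσ hκ hσκ h13 (by linarith : t 2 * t 0 = _) e1 e2
    rw [centroidX_swap] at eX
    rw [centroidY_swap] at eY
    exact ⟨σ, κ, hσ, hκ, hσκ, by rw [eX, eY]⟩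
  · rw [hu, zero_mul] at huv'
    have : 0 < h ^ 2 := by positivity
    linarith
  · obtain ⟨σ, κ, hσ, hκ, hσκ, e1, e2⟩ := exists_angle h0 hu huv'
    obtain ⟨eX, eY⟩ := centroid_eq_locus hh h0 hσ hκ hσκ h02 h13 e1 e2
    exact ⟨σ, κ, hσ, hκ, hσκ, by rw [eX, eY]⟩

theorem exists_sum_product {ρ : ℝ} (hρ : 0 < ρ) (u : ℝ) : ∃ a b, a + b = u ∧ a * b = -ρ := by
  have hs := Real.sq_sqrt (by positivity : 0 ≤ u ^ 2 + 4 * ρ)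
  refine ⟨(u + √(u ^ 2 + 4 * ρ)) / 2, (u - √(u ^ 2 + 4 * ρ)) / 2, by ring, ?_⟩
  linear_combination (-1 / 4) * hs

theorem ne_of_products {ρ a b c d : ℝ} (hρ : ρ ≠ 0) (hab : a * b = -ρ) (hcd : c * d = -ρ)
    (hne : a + b ≠ c + d) : a ≠ c := by
  rintro rfl
  have ha : a ≠ 0 := by
    rintro rfl
    exact hρ (by linarith)
  exact hne (congrArg _ (mul_left_cancel₀ ha (hab.trans hcd.symm)))

theorem paramLocus_subset {f r h : ℝ} (hf : 0 < f) (hr : 0 < r) (hh : h ^ 2 = 1 - h)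
    (h0 : 0 < h) (hρ : r ^ 2 = 4 * (2 * h - 1) * f ^ 2) :
    paramLocus f h ⊆ polarPerimeterLocus f r := by
  rintro _ ⟨s, c, hs, hc, hsc, rfl⟩
  obtain ⟨b1, b2⟩ := golden_bounds hh h0
  have hρ0 : 0 < 2 * h - 1 := by linarith
  -- Opposite vertices are recovered from their sum and product; the product `-ρ` is negative, so
  -- the roots are real and distinct.
  obtain ⟨a₀, a₂, hu, h02⟩ := exists_sum_product hρ0 (2 * h * s / c)
  obtain ⟨a₁, a₃, hv, h13⟩ := exists_sum_product hρ0 (-(2 * h * c / s))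
  have hu0 : 0 < a₀ + a₂ := by rw [hu]; positivity
  have hv0 : a₁ + a₃ < 0 := by
    rw [hv]
    have : 0 < 2 * h * c / s := by positivity
    linarith
  have huv : (a₀ + a₂) * (a₁ + a₃) = -(2 * (1 - (2 * h - 1))) := by
    rw [hu, hv]
    field_simp
    linear_combination -2 * hh
  have h20 : a₂ * a₀ = -(2 * h - 1) := by linarith
  have h31 : a₃ * a₁ = -(2 * h - 1) := by linarith
  have n02 : a₀ ≠ a₂ := by rintro rfl; nlinarith
  have n13 : a₁ ≠ a₃ := by rintro rfl; nlinarith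
  have n01 : a₀ ≠ a₁ := ne_of_products hρ0.ne' h02 h13 (by linarith)
  have n03 : a₀ ≠ a₃ := ne_of_products hρ0.ne' h02 h31 (by linarith)
  have n21 : a₂ ≠ a₁ := ne_of_products hρ0.ne' h20 h13 (by linarith)
  have n23 : a₂ ≠ a₃ := ne_of_products hρ0.ne' h20 h31 (by linarith)
  have hq : (2 * h - 1) ^ 2 + 4 * (2 * h - 1) = 1 := by linear_combination 4 * hh
  have hρ' : 2 * h - 1 < 1 / 4 := by linarith
  have c01 := chord_of_products hq h02 h13 huv
  have c12 := chord_of_products hq h13 h20 (by linear_combination huv)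
  have c23 := chord_of_products hq h20 h31 (by linear_combination huv)
  have c30 := chord_of_products hq h31 h02 (by linear_combination huv)
  set t : Fin 4 → ℝ := ![a₀, a₁, a₂, a₃] with ht
  have hinj : Function.Injective t := by
    intro i j hij
    fin_cases i <;> fin_cases j
    all_goals first
      | rfl
      | exact absurd hij (by assumption)
      | exact absurd hij.symm (by assumption)
  have hfam : (fun i => parabolaPoint f (t i)) ∈ ponceletFamily f r := by
    refine ⟨(parabolaPoint_injective hf.ne').comp hinj, fun i => parabolaPoint_mem _ _, ?_⟩
    intro i
    refine sideTangent_of_chord hf hr hρ hρ' (hinj.ne (by fin_cases i <;> decide)) ?_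
    fin_cases i
    · exact c01
    · exact c12
    · exact c23
    · exact c30
  refine ⟨_, hfam, _, (polar_eq hf.ne' hinj _).mpr rfl, ?_⟩
  rw [perimeterCentroid_eq hf t n02]
  obtain ⟨eX, eY⟩ := centroid_eq_locus hh h0 hs hc hsc h02 h13 hu hv
  show _ = (!₂[f * centroidX a₀ a₁ a₂ a₃, f * centroidY a₀ a₁ a₂ a₃] : Plane)
  rw [eX, eY]

end PolarQuad

end

/-! ### The main theorem -/

theorem mainTheorem9 (f r : ℝ) (hf : 0 < f) (hr : 0 < r) :
    ((PolarQuad.ponceletFamily f r).Nonempty ↔ r / f = 2 * √(√5 - 2)) ∧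
    ((PolarQuad.ponceletFamily f r).Nonempty →
      (PolarQuad.curvePoly f).totalDegree = 10 ∧
      (∃ p ∈ PolarQuad.curve f,
        PolarQuad.polarPerimeterLocus f r = connectedComponentIn (PolarQuad.curve f) p) ∧
      (∀ c ∈ PolarQuad.polarPerimeterLocus f r,
        PolarQuad.lowerLine f ≤ c 0 ∧ c 0 ≤ PolarQuad.upperLine f) ∧
      |PolarQuad.upperLine f - PolarQuad.lowerLine f - f / 25| < f / 1000) := by
  obtain ⟨h, h5⟩ : ∃ h : ℝ, √5 = 2 * h + 1 := ⟨(√5 - 1) / 2, by ring⟩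
  have s5 : (2 * h + 1) ^ 2 = 5 := by rw [← h5]; exact Real.sq_sqrt (by norm_num)
  have hh : h ^ 2 = 1 - h := by linear_combination s5 / 4
  have h0 : 0 < h := by
    have : (1 : ℝ) < √5 := by rw [Real.lt_sqrt] <;> norm_num
    linarith
  have hw : √2 ^ 2 = 2 := Real.sq_sqrt (by norm_num)
  have w0 : 0 < √2 := Real.sqrt_pos.mpr (by norm_num)
  obtain ⟨b1, b2⟩ := PolarQuad.golden_bounds hh h0
  obtain ⟨c1, c2⟩ := PolarQuad.sqrt_two_bounds hw w0
  have hρpos : 0 < 2 * h - 1 := by linarith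
  have hratio : r / f = 2 * √(√5 - 2) ↔ r ^ 2 = 4 * (2 * h - 1) * f ^ 2 := by
    have e : √5 - 2 = 2 * h - 1 := by rw [h5]; ring
    rw [e, div_eq_iff hf.ne', ← sq_eq_sq₀ hr.le (by positivity), mul_pow, mul_pow,
      Real.sq_sqrt hρpos.le]
    norm_num
  have hfwd : (PolarQuad.ponceletFamily f r).Nonempty → r ^ 2 = 4 * (2 * h - 1) * f ^ 2 := by
    rintro ⟨P, hP⟩
    have hρ : r ^ 2 = 4 * (r ^ 2 / (4 * f ^ 2)) * f ^ 2 := by field_simp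
    have hq := (PolarQuad.family_products hf hr hρ hP).1
    have hpos : 0 < r ^ 2 / (4 * f ^ 2) := by positivity
    rw [hρ]
    congr 2
    generalize r ^ 2 / (4 * f ^ 2) = ρ at *
    -- The roots of `ρ² + 4 ρ = 1` sum to `-4`, and `2 h - 1` is the only positive one.
    have : (ρ - (2 * h - 1)) * (ρ + (2 * h - 1) + 4) = 0 := by linear_combination hq - 4 * hh
    linarith [(mul_eq_zero.mp this).resolve_right (by linarith)]
  have hlower : PolarQuad.lowerLine f = f * (h * (2 * h + 1 - √2)) := by
    rw [PolarQuad.lowerLine, h5]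
    linear_combination -2 * f * hh
  have hupper : PolarQuad.upperLine f = f * (h ^ 2 + h ^ 3 * √2 / 2) := by
    rw [PolarQuad.upperLine, h5]
    linear_combination (-f - f * √2 / 2 * (h - 1)) * hh
  refine ⟨⟨fun hne => hratio.mpr (hfwd hne), fun hrf => ?_⟩, fun hne => ?_⟩
  · obtain ⟨p, hp⟩ := PolarQuad.paramLocus_nonempty f h
    obtain ⟨P, hP, -⟩ := PolarQuad.paramLocus_subset hf hr hh h0 (hratio.mp hrf) hp
    exact ⟨P, hP⟩
  · have hr2 := hfwd hne
    have heq : PolarQuad.polarPerimeterLocus f r = PolarQuad.paramLocus f h :=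
      (PolarQuad.polarPerimeterLocus_subset hf hr hh h0 hr2).antisymm
        (PolarQuad.paramLocus_subset hf hr hh h0 hr2)
    rw [heq]
    refine ⟨PolarQuad.totalDegree_curvePoly f,
      PolarQuad.paramLocus_eq_component hf hh h0 h5 hw w0, ?_, ?_⟩
    · rintro _ ⟨s, c, hs, hc, hsc, rfl⟩
      obtain ⟨l1, l2⟩ := PolarQuad.locusX_bounds hh h0 hw w0 hs hc hsc
      rw [hlower, hupper]
      exact ⟨mul_le_mul_of_nonneg_left l1 hf.le, mul_le_mul_of_nonneg_left l2.le hf.le⟩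
    · have e : PolarQuad.upperLine f - PolarQuad.lowerLine f - f / 25
          = f * ((2 * h - 1 / 2) * √2 - 26 / 25) := by
        rw [PolarQuad.lowerLine, PolarQuad.upperLine, h5]
        ring
      have hlow : 1039 / 1000 < (2 * h - 1 / 2) * √2 := by nlinarith
      have hupp : (2 * h - 1 / 2) * √2 < 1041 / 1000 := by nlinarith
      rw [e, abs_lt]
      constructor <;> nlinarith
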